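/- **Definitions.** A *cellular pseudomanifold* is a finite lattice $M$ with least element $\mathbf 0$ and greatest element $\mathbf 1\neq\mathbf 0$ such that for each $x\in M$ all maximal chains from $\mathbf 0$ to $x$ have the same length $\rho(x)$ and, for all $x<z$: (i) if $\rho(z)=\rho(x)+2$, there are exactly two $y$ with $x<y<z$; (ii) if $\rho(z)>\rho(x)+2$, the graph whose vertices are the $y\in[x,z]$ with $\rho(y)=\rho(z)-1$, two of them being adjacent when their meet has rank $\rho(z)-2$, is connected. Its dimension is $\dim M=\rho(\mathbf 1)-2\ge -1$. The *barycentric subdivision* $B(M)$ is the simplicial complex of chains in $M\setminus\{\mathbf 0,\mathbf 1\}$. For $d\ge-1$, a finite simplicial complex is a *combinatorial $d$-sphere* if some subdivision of it is isomorphic to a subdivision of the boundary complex of the $(d+1)$-simplex (for $d=-1$: the complex whose only face is $\emptyset$), and a *combinatorial $d$-manifold* if the link of each of its vertices is a combinatorial $(d-1)$-sphere. A $d$-dimensional cellular pseudomanifold $M$ is a *cellular sphere* (respectively, a *cellular manifold*) if $B(M)$ is a combinatorial $d$-sphere (respectively, $d$-manifold). A *$d$-polytope* ($d\ge 0$) is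 the convex hull in $\mathbb R^d$ of finitely many points, with non-empty interior; its *boundary complex* $\partial X$ is the poset, ordered by inclusion, of its closed faces: $\emptyset$, $X$, and the intersections of $X$ with supporting hyperplanes. A cellular pseudomanifold is a *polytopal sphere* if it is isomorphic, as a poset, to the boundary complex of a polytope. The *direct product* $M\otimes N$ is the set $M\times N$ with the order $(x_1,x_2)\le(y_1,y_2)\iff x_1\le y_1$ and $x_2\le y_2$. The *join* of $X\subseteq\mathbb R^m$ and $Y\subseteq\mathbb R^n$ is $$X*Y=\{t\,(x,0,0)+(1-t)\,(0,y,1) : x\in X,\ y\in Y,\ t\in[0,1]\}\subseteq\mathbb R^{m+n+1}.$$ **Theorem.** Let $M$ and $N$ be cellular pseudomanifolds. 1. If $M$ and $N$ are cellular spheres, then $M\otimes N$ is a cellular sphere. 2. If $M$ and $N$ are polytopal spheres, then $M\otimes N$ is a polytopal sphere. More precisely, if $M\cong\partial X$ and $N\cong\partial Y$ for an $m$-polytope $X\subseteq\mathbb R^m$ and an $n$-polytope $Y\subseteq\mathbb R^n$, then $X*Y$ is an $(m+n+1)$-polytope and $M\otimes N\cong\partial(X*Y)$. 3. If $M\otimes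 N$ is a cellular manifold, then $M$ and $N$ are cellular spheres, and hence $M\otimes N$ is a cellular sphere. -/

import Mathlib

namespace CellPM

noncomputable section

/-! ### Finite simplicial complexes and combinatorial spheres

Complexes are Mathlib's `PreAbstractSimplicialComplex`, whose faces are nonempty finite sets of
vertices; the trivial face `∅` and the fake face `V` (the whole vertex set), which play no role in
geometric carriers, links and isomorphisms, are not listed. -/

section Complexes

variable {V W : Type*}

/-- The geometric simplex spanned by a finite set `A` of vertices, a vertex `v` being realised as
the unit vector `e_v` of `ℝ^V`: points are given by their barycentric coordinates. -/
def faceCarrier (A : Finset V) : Set (V → ℝ) :=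
  {t | (∀ v, 0 ≤ t v) ∧ (∀ v, v ∉ A → t v = 0) ∧ ∑ v ∈ A, t v = 1}

/-- The geometric carrier `|K|`, the union of the carriers of the faces. -/
def carrier (K : PreAbstractSimplicialComplex V) : Set (V → ℝ) :=
  ⋃ A ∈ K.faces, faceCarrier A

/-- `K'` is a subdivision of `K`: there is a homeomorphism `|K'| → |K|` that is affine on `|A|`
for each face `A` of `K'`. -/
def IsSubdivision (K' : PreAbstractSimplicialComplex V) (K : PreAbstractSimplicialComplex W) :
    Prop :=
  ∃ f : carrier K' ≃ₜ carrier K, ∀ A ∈ K'.faces, ∃ g : (V → ℝ) →ᵃ[ℝ] (W → ℝ),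
    ∀ x : carrier K', x.1 ∈ faceCarrier A → (f x).1 = g x.1

/-- An isomorphism is an inclusion-preserving bijection between the sets of faces. -/
def Isomorphic (K : PreAbstractSimplicialComplex V) (L : PreAbstractSimplicialComplex W) : Prop :=
  Nonempty (K.faces ≃o L.faces)

/-- Combinatorial equivalence: having isomorphic (finite) subdivisions. -/
def CombEquiv (K : PreAbstractSimplicialComplex V) (L : PreAbstractSimplicialComplex W) : Prop :=
  ∃ (m n : ℕ) (K' : PreAbstractSimplicialComplex (Fin m))
    (L' : PreAbstractSimplicialComplex (Fin n)),
    IsSubdivision K' K ∧ IsSubdivision L' L ∧ Isomorphic K' L'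

/-- The standard `d`-sphere (`d ≥ -1`): all proper (nonempty) subsets of a set of size `d + 2`. -/
def stdSphere (d : ℤ) : PreAbstractSimplicialComplex (Fin (d + 2).toNat) where
  faces := {s | s.Nonempty ∧ s ≠ Finset.univ}
  isRelLowerSet_faces := by
    intro s hs
    refine ⟨hs.1, fun t hts ht => ⟨ht, ?_⟩⟩
    rintro rfl
    exact hs.2 (Finset.univ_subset_iff.mp hts)

/-- `K` is a combinatorial `d`-sphere, `d ≥ -1`. The `(-1)`-sphere is the complex without
(nonempty) faces. -/
def IsCombinatorialSphere (d : ℤ) (K : PreAbstractSimplicialComplex V) : Prop :=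
  -1 ≤ d ∧ CombEquiv K (stdSphere d)

open Classical in
/-- The link of a vertex `x`: the sets `F \ {x}`, where `F` is a face containing `x`. -/
def link (K : PreAbstractSimplicialComplex V) (x : V) : PreAbstractSimplicialComplex V where
  faces := {s | s.Nonempty ∧ ∃ F ∈ K.faces, x ∈ F ∧ s = F.erase x}
  isRelLowerSet_faces := by
    rintro s ⟨hs, F, hF, hx, rfl⟩
    refine ⟨hs, fun t hts ht => ⟨ht, insert x t, ?_, Finset.mem_insert_self x t, ?_⟩⟩
    · refine (K.isRelLowerSet_faces hF).2 ?_ (Finset.insert_nonempty x t)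
      intro y hy
      rcases Finset.mem_insert.mp hy with rfl | hy
      · exact hx
      · exact Finset.mem_of_mem_erase (hts hy)
    · exact (Finset.erase_insert fun h => (Finset.mem_erase.mp (hts h)).1 rfl).symm

/-- `K` is a combinatorial `d`-manifold: the link of each vertex is a combinatorial
`(d - 1)`-sphere. -/
def IsCombinatorialManifold (d : ℤ) (K : PreAbstractSimplicialComplex V) : Prop :=
  ∀ x : V, {x} ∈ K.faces → IsCombinatorialSphere (d - 1) (link K x)

end Complexes

/-! ### Cellular pseudomanifolds -/

section Cellular

variable (M : Type*) [Lattice M] [BoundedOrder M]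

variable {M} in
/-- The rank of an element: the length of a longest chain from `⊥` to it. -/
def rank (x : M) : ℕ := (Order.height x).toNat

/-- All maximal (i.e. saturated) chains joining `⊥` to an element have the same length, its
rank. -/
def IsRanked : Prop :=
  ∀ s : RelSeries {(a, b) : M × M | a ⋖ b}, s.head = ⊥ → s.length = rank s.last

variable {M} in
/-- The graph `Λ([x, z])` of the interval `[x, z]`, written with the rank function of the ambient
lattice: its vertices are the elements of `[x, z]` of corank one, and two of them are adjacent if
their meet has corank two. -/
def facetGraph (x z : M) : SimpleGraph {y : M // x ≤ y ∧ y ≤ z ∧ rank y + 1 = rank z} where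
  Adj s t := rank (s.1 ⊓ t.1) + 2 = rank z
  symm := ⟨fun s t h => by rw [inf_comm]; exact h⟩
  loopless := ⟨fun s h => by
    have h1 := s.2.2.2
    rw [inf_idem] at h
    omega⟩

/-- A cellular pseudomanifold (of dimension at least `-1`, so `⊥ ≠ ⊤`). -/
structure IsCellularPseudomanifold : Prop where
  finite : Finite M
  nontrivial : Nontrivial M
  ranked : IsRanked M
  thin : ∀ x z : M, x < z → rank z = rank x + 2 → (Set.Ioo x z).ncard = 2
  connected : ∀ x z : M, x < z → rank x + 2 < rank z → (facetGraph x z).Connected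

/-- The dimension of a cellular pseudomanifold: `dim ⊤ - 1`, where `dim f = rank f - 1`. -/
def dim : ℤ := (rank (⊤ : M) : ℤ) - 2

/-- The barycentric subdivision `B(M)`: its vertices are the proper faces of `M`, its faces the
(nonempty) chains of proper faces. -/
def barycentric : PreAbstractSimplicialComplex {x : M // x ≠ ⊥ ∧ x ≠ ⊤} where
  faces := {s | s.Nonempty ∧ IsChain (· ≤ ·) (s : Set {x : M // x ≠ ⊥ ∧ x ≠ ⊤})}
  isRelLowerSet_faces := fun _ hs =>
    ⟨hs.1, fun _ hts ht => ⟨ht, hs.2.mono (Finset.coe_subset.mpr hts)⟩⟩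

/-- A cellular `d`-sphere: a `d`-dimensional cellular pseudomanifold whose barycentric subdivision
is a combinatorial `d`-sphere. -/
def IsCellularSphere : Prop :=
  IsCellularPseudomanifold M ∧ IsCombinatorialSphere (dim M) (barycentric M)

/-- A cellular `d`-manifold: a `d`-dimensional cellular pseudomanifold whose barycentric
subdivision is a combinatorial `d`-manifold. -/
def IsCellularManifold : Prop :=
  IsCellularPseudomanifold M ∧ IsCombinatorialManifold (dim M) (barycentric M)

/-- A `d`-polytope in `ℝ^d`: the convex hull of finitely many points, with nonempty interior. -/
def IsPolytope {d : ℕ} (X : Set (Fin d → ℝ)) : Prop :=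
  (∃ S : Finset (Fin d → ℝ), X = convexHull ℝ (S : Set (Fin d → ℝ))) ∧ (interior X).Nonempty

/-- The boundary complex of `X`: the poset of closed faces of `X`, ordered by inclusion. Mathlib's
exposed subsets are `∅`, the intersections of `X` with supporting hyperplanes, and `X` itself
(zero functional). -/
abbrev BoundaryComplex {d : ℕ} (X : Set (Fin d → ℝ)) : Type :=
  {F : Set (Fin d → ℝ) // IsExposed ℝ X F}

/-- A polytopal sphere: a cellular pseudomanifold isomorphic to the boundary complex of a
polytope. -/
def IsPolytopal : Prop :=
  IsCellularPseudomanifold M ∧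
    ∃ (d : ℕ) (X : Set (Fin d → ℝ)), IsPolytope X ∧ Nonempty (M ≃o BoundaryComplex X)

/-- The direct product: the product set with the product order, for which `(x₁, x₂) < (y₁, y₂)` iff
`x₁ ≤ y₁` and `x₂ < y₂`, or `x₁ < y₁` and `x₂ ≤ y₂`. -/
abbrev DirectProduct (M N : Type*) : Type _ := M × N

/-- The map `x ↦ (x, 0, 0)` from `ℝ^m` to `ℝ^(m+n+1)`. -/
def joinLeft (m n : ℕ) (x : Fin m → ℝ) : Fin (m + n + 1) → ℝ :=
  Fin.append (Fin.append x (fun _ : Fin n => (0 : ℝ))) (fun _ : Fin 1 => (0 : ℝ))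

/-- The map `y ↦ (0, y, 1)` from `ℝ^n` to `ℝ^(m+n+1)`. -/
def joinRight (m n : ℕ) (y : Fin n → ℝ) : Fin (m + n + 1) → ℝ :=
  Fin.append (Fin.append (fun _ : Fin m => (0 : ℝ)) y) (fun _ : Fin 1 => (1 : ℝ))

/-- The (external) join of two nonempty sets `A ⊆ ℝ^m`, `B ⊆ ℝ^n`. -/
def polytopeJoin {m n : ℕ} (A : Set (Fin m → ℝ)) (B : Set (Fin n → ℝ)) :
    Set (Fin (m + n + 1) → ℝ) :=
  {z | ∃ x ∈ A, ∃ y ∈ B, ∃ t ∈ Set.Icc (0 : ℝ) 1,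
    z = t • joinLeft m n x + (1 - t) • joinRight m n y}

end Cellular

end

end CellPM

namespace CellPM

open Set Function

/-! The piecewise linear topology is homogenized. A complex on `V` is replaced by the cone of
nonnegative vectors in `V → ℝ` supported on a face. A subdivision then becomes a linear map that is
bijective between cones (`bijOn_cone_of_isSubdivision`, `isSubdivision_of_bijOn_cone`),
combinatorial equivalence becomes `PLEquiv`, and a `d`-sphere is a complex whose cone is piecewise
linearly equivalent to a real vector space of dimension `d + 1` (`isCombinatorialSphere_iff`). Joins
of complexes become products of cones. Transitivity of `PLEquiv` rests on common refinements,
obtained by cutting a complex along hyperplanes through stellar subdivisions of edges.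

Spheres: a point of the cone over the order complex of `M × N` is a nonnegative matrix supported on
a chain. Such a matrix is determined by its row and column sums, and any two chain-supported vectors
with equal totals occur as such sums (the north-west corner rule). Discarding `⊥` and `⊤` leaves the
proper marginals and one real number, the difference of the two marginals at `⊥`. Hence `B(M ⊗ N)`
subdivides `B(M) * B(N) * S⁰` (`bijOn_mergeMap`), and a product of vector spaces is a vector space.

Converse: `mergeMap` sends the vertex `(⊤, ⊥)` to a pole of `S⁰`, so its link is equivalent to `B(M)
* B(N)` (`plEquiv_link_topBot`). In a manifold this link is a sphere. Links of vertices in spheres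
are spheres (`PLEquiv.linkFaces`), so successive links at the vertices of a maximal simplex of
`B(N)` strip off the second factor and leave `B(M)` (`PLEquiv.of_join`).

Polytopes: a face of `X * Y` is determined by its traces on `X` and `Y`, because faces are extreme.
Every pair of faces occurs, because functionals on `X` and `Y` can be glued with an arbitrary
relative constant carried by the last coordinate. -/

/-- The cone over a (possibly empty) family of faces closed under passing to subsets. -/
def cone {V : Type*} (D : LowerSet (Set V)) : Set (V → ℝ) := {t | 0 ≤ t ∧ support t ∈ D}

/-! ### Homogeneous piecewise linear equivalence -/

section PLEquiv

variable {V W E F G E' F' : Type*} [AddCommGroup E] [Module ℝ E] [AddCommGroup F] [Module ℝ F]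
  [AddCommGroup G] [Module ℝ G] [AddCommGroup E'] [Module ℝ E'] [AddCommGroup F'] [Module ℝ F']

/-- Positively homogeneous piecewise linear equivalence: both sets are bijective linear images of
the cone over the same finite simplicial complex. -/
def PLEquiv (S : Set E) (T : Set F) : Prop :=
  ∃ (m : ℕ) (D : LowerSet (Set (Fin m))) (f : (Fin m → ℝ) →ₗ[ℝ] E) (g : (Fin m → ℝ) →ₗ[ℝ] F),
    BijOn f (cone D) S ∧ BijOn g (cone D) T

theorem PLEquiv.symm {S : Set E} {T : Set F} (h : PLEquiv S T) : PLEquiv T S := by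
  obtain ⟨m, D, f, g, hf, hg⟩ := h
  exact ⟨m, D, g, f, hg, hf⟩

/-- The family of sets whose preimage under `φ` belongs to `D`. -/
def pullFaces (φ : V → W) (D : LowerSet (Set V)) : LowerSet (Set W) where
  carrier := {s | φ ⁻¹' s ∈ D}
  lower' := fun _ _ hst hs => D.lower (preimage_mono hst) hs

theorem bijOn_funLeft (e : V ≃ W) (D : LowerSet (Set V)) :
    BijOn (LinearMap.funLeft ℝ ℝ e) (cone (pullFaces e D)) (cone D) := by
  refine ⟨fun t ht => ⟨fun v => ht.1 (e v), ht.2⟩, fun t _ t' _ h => ?_, fun t ht => ?_⟩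
  · ext w
    have := congrFun h (e.symm w)
    simpa [LinearMap.funLeft] using this
  · refine ⟨fun w => t (e.symm w), ⟨fun w => ht.1 _, ?_⟩, ?_⟩
    · have : e ⁻¹' support (fun w => t (e.symm w)) = support t := by ext; simp
      change e ⁻¹' support (fun w => t (e.symm w)) ∈ D
      rw [this]; exact ht.2
    · ext v; simp [LinearMap.funLeft]

/-- The vertex type `Fin m` in `PLEquiv` is only a normal form; relabelling vertices is a linear
bijection of cones. -/
theorem PLEquiv.of_bijOn [Finite V] {D : LowerSet (Set V)} {f : (V → ℝ) →ₗ[ℝ] E}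
    {g : (V → ℝ) →ₗ[ℝ] F} {S : Set E} {T : Set F} (hf : BijOn f (cone D) S)
    (hg : BijOn g (cone D) T) : PLEquiv S T := by
  obtain ⟨m, ⟨e⟩⟩ := Finite.exists_equiv_fin V
  exact ⟨m, pullFaces e D, f ∘ₗ LinearMap.funLeft ℝ ℝ e, g ∘ₗ LinearMap.funLeft ℝ ℝ e,
    hf.comp (bijOn_funLeft e D), hg.comp (bijOn_funLeft e D)⟩

theorem PLEquiv.of_cone [Finite V] {D : LowerSet (Set V)} {f : (V → ℝ) →ₗ[ℝ] E} {S : Set E}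
    (hf : BijOn f (cone D) S) : PLEquiv (cone D) S :=
  .of_bijOn (f := LinearMap.id) (by simpa using bijOn_id _) hf

theorem PLEquiv.map {S : Set E} {T : Set F} (h : PLEquiv S T) {f : F →ₗ[ℝ] G} {U : Set G}
    (hf : BijOn f T U) : PLEquiv S U := by
  obtain ⟨m, D, p, q, hp, hq⟩ := h
  exact ⟨m, D, p, f ∘ₗ q, hp, hf.comp hq⟩

/-- The join of two complexes. -/
def joinFaces (D : LowerSet (Set V)) (D' : LowerSet (Set W)) : LowerSet (Set (V ⊕ W)) where
  carrier := {s | Sum.inl ⁻¹' s ∈ D ∧ Sum.inr ⁻¹' s ∈ D'}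
  lower' := fun _ _ hst hs =>
    ⟨D.lower (preimage_mono hst) hs.1, D'.lower (preimage_mono hst) hs.2⟩

/-- The cone over a join is the product of the cones. -/
theorem bijOn_joinFaces (D : LowerSet (Set V)) (D' : LowerSet (Set W)) :
    BijOn ((LinearMap.funLeft ℝ ℝ Sum.inl).prod (LinearMap.funLeft ℝ ℝ Sum.inr))
      (cone (joinFaces D D')) (cone D ×ˢ cone D') := by
  refine ⟨fun t ht => ⟨⟨fun v => ht.1 _, ht.2.1⟩, ⟨fun v => ht.1 _, ht.2.2⟩⟩,
    fun t _ t' _ h => ?_, fun ⟨a, b⟩ ⟨ha, hb⟩ => ?_⟩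
  · have h1 := congrArg Prod.fst h
    have h2 := congrArg Prod.snd h
    ext (v | w)
    · exact congrFun h1 v
    · exact congrFun h2 w
  · exact ⟨Sum.elim a b, ⟨by rintro (v | w); exacts [ha.1 v, hb.1 w], ⟨ha.2, hb.2⟩⟩, rfl⟩

theorem PLEquiv.prod {S : Set E} {T : Set F} {S' : Set E'} {T' : Set F'} (h : PLEquiv S T)
    (h' : PLEquiv S' T') : PLEquiv (S ×ˢ S') (T ×ˢ T') := by
  obtain ⟨m, D, f, g, hf, hg⟩ := h
  obtain ⟨m', D', f', g', hf', hg'⟩ := h'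
  exact .of_bijOn (f := f.prodMap f' ∘ₗ _) (g := g.prodMap g' ∘ₗ _)
    ((hf.prodMap hf').comp (bijOn_joinFaces D D')) ((hg.prodMap hg').comp (bijOn_joinFaces D D'))

/-- A linear map that is injective on the cone over a complex is injective on the linear span of
each face. -/
theorem injOn_span {D : LowerSet (Set V)} {f : (V → ℝ) →ₗ[ℝ] E} (hf : InjOn f (cone D)) {A : Set V}
    (hA : A ∈ D) : InjOn f {t | support t ⊆ A} := by
  intro u hu u' hu' h
  -- Moving negative parts to the other side turns an equation between signed vectors into one
  -- between points of the cone.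
  have key : ∀ a b : V → ℝ, support a ⊆ A → support b ⊆ A → a⁺ + b⁻ ∈ cone D := by
    intro a b ha hb
    refine ⟨add_nonneg (posPart_nonneg a) (negPart_nonneg b), D.lower ?_ hA⟩
    intro v hv
    by_contra hvA
    have h1 : a v = 0 := by_contra fun h => hvA (ha h)
    have h2 : b v = 0 := by_contra fun h => hvA (hb h)
    exact hv (by simp [Pi.posPart_apply, Pi.negPart_apply, h1, h2])
  have h3 : u⁺ + u'⁻ = u'⁺ + u⁻ := by
    refine hf (key _ _ hu hu') (key _ _ hu' hu) ?_
    have e1 : f u = f u⁺ - f u⁻ := by rw [← map_sub, posPart_sub_negPart]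
    have e2 : f u' = f u'⁺ - f u'⁻ := by rw [← map_sub, posPart_sub_negPart]
    rw [e1, e2] at h
    rw [map_add, map_add]
    exact sub_eq_sub_iff_add_eq_add.mp h
  rw [← posPart_sub_negPart u, ← posPart_sub_negPart u']
  exact sub_eq_sub_iff_add_eq_add.mpr h3

theorem single_mem_cone [DecidableEq V] {D : LowerSet (Set V)} {v : V} (h : {v} ∈ D) {c : ℝ}
    (hc : 0 ≤ c) : Pi.single v c ∈ cone D :=
  ⟨Pi.single_nonneg.mpr hc, D.lower Pi.support_single_subset h⟩

end PLEquiv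

/-! ### Stellar subdivision of an edge -/

section Stellar

variable {V : Type*}

/-- The stellar subdivision of a complex at the edge `{u, v}`, the new vertex being `none`. -/
def starEdge (D : LowerSet (Set V)) (u v : V) : LowerSet (Set (Option V)) where
  carrier := {s | ¬ (some u ∈ s ∧ some v ∈ s) ∧
    {x | some x ∈ s ∨ none ∈ s ∧ (x = u ∨ x = v)} ∈ D}
  lower' := fun _ _ hts hs => ⟨fun h => hs.1 ⟨hts h.1, hts h.2⟩,
    D.lower (fun _ hx => hx.imp (fun h => hts h) (fun h => ⟨hts h.1, h.2⟩)) hs.2⟩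

/-- The linear map putting the new vertex of an edge subdivision at `q`. -/
def starMap (q : V → ℝ) : (Option V → ℝ) →ₗ[ℝ] (V → ℝ) :=
  LinearMap.funLeft ℝ ℝ some + (LinearMap.proj none).smulRight q

@[simp]
theorem starMap_apply (q : V → ℝ) (t : Option V → ℝ) (x : V) :
    starMap q t x = t (some x) + t none * q x := rfl

/-- No face of the subdivision contains both `u` and `v`, so the weight of the new vertex is forced.
It is the largest multiple of the new point that can be subtracted from `s` without a coordinate
becoming negative, namely `min (s u / a) (s v / b)`. -/
theorem bijOn_starMap [DecidableEq V] (D : LowerSet (Set V)) {u v : V} (huv : u ≠ v) {a b : ℝ}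
    (ha : 0 < a) (hb : 0 < b) :
    BijOn (starMap (Pi.single u a + Pi.single v b)) (cone (starEdge D u v)) (cone D) := by
  set q : V → ℝ := Pi.single u a + Pi.single v b with hq
  have qu : q u = a := by simp [hq, huv]
  have qv : q v = b := by simp [hq, huv.symm]
  have qx : ∀ x, x ≠ u → x ≠ v → q x = 0 := fun x h1 h2 => by simp [hq, h1, h2]
  have q0 : ∀ x, 0 ≤ q x := fun x => by
    by_cases h1 : x = u
    · rw [h1, qu]; exact ha.le
    by_cases h2 : x = v
    · rw [h2, qv]; exact hb.le
    · rw [qx x h1 h2]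
  have supp : ∀ t : Option V → ℝ, 0 ≤ t → support (starMap q t) =
      {x | some x ∈ support t ∨ none ∈ support t ∧ (x = u ∨ x = v)} := by
    intro t ht
    ext x
    have h1 := ht (some x)
    have h2 := mul_nonneg (ht none) (q0 x)
    simp only [Pi.zero_apply] at h1 h2
    simp only [mem_support, starMap_apply, ne_eq, mem_ofPred_eq]
    rw [add_eq_zero_iff_of_nonneg h1 h2, mul_eq_zero, not_and_or, not_or]
    have : ¬ q x = 0 ↔ (x = u ∨ x = v) := by
      constructor
      · intro h; by_contra! h'; exact h (qx x h'.1 h'.2)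
      · rintro (rfl | rfl)
        · rw [qu]; exact ha.ne'
        · rw [qv]; exact hb.ne'
    rw [this]
  have hrec : ∀ t ∈ cone (starEdge D u v),
      t none = min (starMap q t u / a) (starMap q t v / b) := by
    intro t ht
    have e1 : starMap q t u / a = t (some u) / a + t none := by
      rw [starMap_apply, qu]; field_simp
    have e2 : starMap q t v / b = t (some v) / b + t none := by
      rw [starMap_apply, qv]; field_simp
    have p1 : 0 ≤ t (some u) / a := div_nonneg (ht.1 _) ha.le
    have p2 : 0 ≤ t (some v) / b := div_nonneg (ht.1 _) hb.le
    have : t (some u) = 0 ∨ t (some v) = 0 := by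
      by_contra! h; exact ht.2.1 h
    rw [e1, e2]
    rcases this with h | h
    · rw [min_eq_left] <;> simp [h, p2]
    · rw [min_eq_right] <;> simp [h, p1]
  refine ⟨fun t ht => ⟨fun x => ?_, ?_⟩, fun t ht t' ht' h => ?_, fun s hs => ?_⟩
  · exact add_nonneg (ht.1 _) (mul_nonneg (ht.1 _) (q0 x))
  · rw [supp t ht.1]; exact ht.2.2
  · have h0 : t none = t' none := by rw [hrec t ht, hrec t' ht', h]
    ext (_ | x)
    · exact h0
    · have := congrFun h x
      simp only [starMap_apply, h0] at this
      linarith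
  · set c := min (s u / a) (s v / b) with hc
    have c0 : 0 ≤ c := le_min (div_nonneg (hs.1 _) ha.le) (div_nonneg (hs.1 _) hb.le)
    have cu : c * a ≤ s u := (le_div_iff₀ ha).mp (min_le_left _ _)
    have cv : c * b ≤ s v := (le_div_iff₀ hb).mp (min_le_right _ _)
    let t : Option V → ℝ := fun o => o.elim c fun x => s x - c * q x
    have hts : starMap q t = s := by
      ext x; simp [t]
    have ht0 : 0 ≤ t := by
      rintro (_ | x)
      · exact c0
      · change 0 ≤ s x - c * q x
        by_cases h1 : x = u
        · rw [h1, qu]; linarith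
        by_cases h2 : x = v
        · rw [h2, qv]; linarith
        · rw [qx x h1 h2]; simpa using hs.1 x
    refine ⟨t, ⟨ht0, ?_, ?_⟩, hts⟩
    · rintro ⟨h1, h2⟩
      simp only [mem_support, t, Option.elim, qu, qv] at h1 h2
      rcases min_choice (s u / a) (s v / b) with h | h
      · exact h1 (by rw [hc, h]; field_simp; ring)
      · exact h2 (by rw [hc, h]; field_simp; ring)
    · rw [← supp t ht0, hts]; exact hs.2

end Stellar

/-! ### Cutting along hyperplanes and common refinements -/

section Refinement

variable {V W E F G : Type*} [AddCommGroup E] [Module ℝ E] [AddCommGroup F] [Module ℝ F]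
  [AddCommGroup G] [Module ℝ G]

theorem singleton_mem_of_mem {D : LowerSet (Set V)} {s : Set V} (hs : s ∈ D) {v : V} (hv : v ∈ s) :
    {v} ∈ D := D.lower (singleton_subset_iff.mpr hv) hs

theorem map_eq_sum_single [Fintype V] [DecidableEq V] (f : (V → ℝ) →ₗ[ℝ] E) (t : V → ℝ) :
    f t = ∑ v, t v • f (Pi.single v 1) := by
  conv_lhs => rw [LinearMap.pi_apply_eq_sum_univ f t]
  refine Finset.sum_congr rfl fun v _ => ?_
  congr 2
  ext w
  simp [Pi.single_apply, eq_comm]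

theorem indicator_mem_cone {D : LowerSet (Set V)} {s : Set V} (hs : s ∈ D) :
    s.indicator (fun _ => (1 : ℝ)) ∈ cone D :=
  ⟨indicator_nonneg fun _ _ => zero_le_one, D.lower support_indicator_subset hs⟩

/-- A linear map between cones sends every face into a face. -/
theorem exists_face_of_mapsTo [Finite V] [DecidableEq V] {D : LowerSet (Set V)}
    {D' : LowerSet (Set W)} {r : (V → ℝ) →ₗ[ℝ] (W → ℝ)} (hr : MapsTo r (cone D) (cone D'))
    {s : Set V} (hs : s ∈ D) :
    ∃ B ∈ D', ∀ i ∈ s, 0 ≤ r (Pi.single i 1) ∧ support (r (Pi.single i 1)) ⊆ B := by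
  classical
  cases nonempty_fintype V
  have h0 : ∀ i ∈ s, 0 ≤ r (Pi.single i 1) := fun i hi =>
    (hr (single_mem_cone (singleton_mem_of_mem hs hi) zero_le_one)).1
  -- The images of the vertices of `s` are nonnegative, so nothing cancels in their sum, and its
  -- support contains the support of each of them.
  refine ⟨_, (hr (indicator_mem_cone hs)).2, fun i hi => ⟨h0 i hi, fun w hw => ?_⟩⟩
  rw [map_eq_sum_single r]
  simp only [mem_support, Finset.sum_apply, Pi.smul_apply, smul_eq_mul]
  refine (Finset.sum_pos' (fun j _ => ?_) ⟨i, Finset.mem_univ i, ?_⟩).ne'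
  · by_cases hj : j ∈ s
    · simpa [hj] using h0 j hj w
    · simp [hj]
  · simpa [hi] using lt_of_le_of_ne (h0 i hi w) (Ne.symm hw)

/-- `ℓ` does not change sign on any face. -/
def ConstSign [DecidableEq V] (D : LowerSet (Set V)) (l : (V → ℝ) →ₗ[ℝ] ℝ) : Prop :=
  ∀ s ∈ D, (∀ i ∈ s, 0 ≤ l (Pi.single i 1)) ∨ ∀ i ∈ s, l (Pi.single i 1) ≤ 0

/-- Further subdivision does not spoil a cut already made: the vertices of a face go to nonnegative
combinations of the vertices of a single face. -/
theorem ConstSign.comp [Finite V] [Finite W] [DecidableEq V] [DecidableEq W] {D : LowerSet (Set V)}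
    {D' : LowerSet (Set W)} {l : (W → ℝ) →ₗ[ℝ] ℝ} (h : ConstSign D' l)
    {r : (V → ℝ) →ₗ[ℝ] (W → ℝ)} (hr : MapsTo r (cone D) (cone D')) : ConstSign D (l ∘ₗ r) := by
  cases nonempty_fintype W
  intro s hs
  obtain ⟨B, hB, hsB⟩ := exists_face_of_mapsTo hr hs
  refine (h B hB).imp (fun hl i hi => ?_) (fun hl i hi => ?_)
  all_goals
    rw [LinearMap.comp_apply, map_eq_sum_single l]
    have key : ∀ w, 0 ≤ r (Pi.single i 1) w ∧ (w ∉ B → r (Pi.single i 1) w = 0) := fun w =>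
      ⟨(hsB i hi).1 w, fun hw => by_contra fun h => hw ((hsB i hi).2 h)⟩
  · refine Finset.sum_nonneg fun w _ => ?_
    by_cases hw : w ∈ B
    · exact mul_nonneg (key w).1 (hl w hw)
    · simp [(key w).2 hw]
  · refine Finset.sum_nonpos fun w _ => ?_
    by_cases hw : w ∈ B
    · exact mul_nonpos_of_nonneg_of_nonpos (key w).1 (hl w hw)
    · simp [(key w).2 hw]

/-- Edges of a complex whose end points lie strictly on different sides of a hyperplane. -/
def crossing [DecidableEq V] (D : LowerSet (Set V)) (l : (V → ℝ) →ₗ[ℝ] ℝ) : Set (V × V) :=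
  {p | 0 < l (Pi.single p.1 1) ∧ l (Pi.single p.2 1) < 0 ∧ {p.1, p.2} ∈ D}

/-- Every complex can be subdivided along a hyperplane. -/
theorem exists_constSign (n : ℕ) : ∀ (V : Type) [Finite V] [DecidableEq V] (D : LowerSet (Set V))
    (l : (V → ℝ) →ₗ[ℝ] ℝ), (crossing D l).ncard = n →
    ∃ (V' : Type) (_ : Finite V') (_ : DecidableEq V') (D' : LowerSet (Set V'))
      (r : (V' → ℝ) →ₗ[ℝ] (V → ℝ)), BijOn r (cone D') (cone D) ∧ ConstSign D' (l ∘ₗ r) := by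
  induction n using Nat.strong_induction_on with
  | _ n ih =>
  intro V _ _ D l hn
  by_cases hc : crossing D l = ∅
  · refine ⟨V, inferInstance, inferInstance, D, LinearMap.id, bijOn_id _, fun s hs => ?_⟩
    by_contra! h
    obtain ⟨⟨v, hv, hv'⟩, u, hu, hu'⟩ := h
    have : (u, v) ∈ crossing D l :=
      ⟨hu', hv', D.lower (insert_subset_iff.mpr ⟨hu, singleton_subset_iff.mpr hv⟩) hs⟩
    simp [hc] at this
  · obtain ⟨⟨u, v⟩, hu, hv, huvD⟩ := nonempty_iff_ne_empty.mpr hc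
    simp only at hu hv huvD
    have huv : u ≠ v := by rintro rfl; exact lt_asymm hu hv
    -- Both weights are positive, and they are chosen so that `l q = 0`: the new vertex lies on the
    -- hyperplane.
    set q : V → ℝ := Pi.single u (-l (Pi.single v 1)) + Pi.single v (l (Pi.single u 1)) with hq
    have hbij := bijOn_starMap D huv (neg_pos.mpr hv) hu
    rw [← hq] at hbij
    have hsome : ∀ x : V, starMap q (Pi.single (some x) 1) = Pi.single x 1 := by
      intro x; ext y; simp [Pi.single_apply]
    have hnone : l (starMap q (Pi.single none 1)) = 0 := by
      have : starMap q (Pi.single none 1) = q := by ext y; simp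
      have e : ∀ (x : V) (c : ℝ), (Pi.single x c : V → ℝ) = c • Pi.single x 1 := fun x c => by
        rw [← Pi.single_smul]; simp
      rw [this, hq, e u (-_), e v (l _), map_add, map_smul, map_smul]
      simp only [smul_eq_mul]; ring
    -- No crossing edge ends at the new vertex, since `l` vanishes there, and the edge from `u` to
    -- `v` has disappeared.
    have hlt : (crossing (starEdge D u v) (l ∘ₗ starMap q)).ncard < n := by
      rw [← hn]
      have hsub : crossing (starEdge D u v) (l ∘ₗ starMap q) ⊆
          Prod.map some some '' (crossing D l \ {(u, v)}) := by
        rintro ⟨_ | x, _ | y⟩ ⟨hx, hy, hxy⟩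
        · simp [hnone] at hx
        · simp [hnone] at hx
        · simp [hnone] at hy
        · simp only [LinearMap.comp_apply, hsome] at hx hy
          refine ⟨(x, y), ⟨⟨hx, hy, D.lower ?_ hxy.2⟩, ?_⟩, rfl⟩
          · rintro z (rfl | rfl) <;> simp
          · rintro h
            obtain ⟨rfl, rfl⟩ := Prod.mk.inj h
            exact hxy.1 (by simp)
      calc _ ≤ _ := ncard_le_ncard hsub (toFinite _)
        _ ≤ _ := ncard_image_le (toFinite _)
        _ < _ := ncard_sdiff_singleton_lt_of_mem (a := (u, v)) ⟨hu, hv, huvD⟩ (toFinite _)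
    obtain ⟨V', h1, h2, D', r, hr, hcs⟩ := ih _ hlt (Option V) (starEdge D u v) (l ∘ₗ starMap q) rfl
    exact ⟨V', h1, h2, D', starMap q ∘ₗ r, hbij.comp hr, hcs⟩

/-- Every complex can be subdivided along finitely many hyperplanes. -/
theorem exists_constSign_finset (V : Type) [Finite V] (D : LowerSet (Set V))
    {L : Set ((V → ℝ) →ₗ[ℝ] ℝ)} (hL : L.Finite) :
    ∃ (V' : Type) (_ : Finite V') (_ : DecidableEq V') (D' : LowerSet (Set V'))
      (r : (V' → ℝ) →ₗ[ℝ] (V → ℝ)), BijOn r (cone D') (cone D) ∧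
      ∀ l ∈ L, ConstSign D' (l ∘ₗ r) := by
  classical
  induction L, hL using Set.Finite.induction_on with
  | empty => exact ⟨V, inferInstance, inferInstance, D, LinearMap.id, bijOn_id _, by simp⟩
  | @insert l L _ _ ih =>
    obtain ⟨V₁, _, _, D₁, r₁, hr₁, hL₁⟩ := ih
    obtain ⟨V₂, h1, h2, D₂, r₂, hr₂, hl⟩ := exists_constSign _ V₁ D₁ (l ∘ₗ r₁) rfl
    refine ⟨V₂, h1, h2, D₂, r₁ ∘ₗ r₂, hr₁.comp hr₂, ?_⟩
    rintro l' (rfl | hl')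
    · exact hl
    · exact (hL₁ l' hl').comp hr₂.mapsTo

/-- The image of a face under a linear map that is injective on the cone over a complex is cut out
by finitely many half-spaces. -/
theorem exists_halfSpaces [Finite V] [FiniteDimensional ℝ F] {D : LowerSet (Set V)}
    {g : (V → ℝ) →ₗ[ℝ] F} (hg : InjOn g (cone D)) {B : Set V} (hB : B ∈ D) :
    ∃ L : Set (F →ₗ[ℝ] ℝ), L.Finite ∧
      ∀ x, (∃ t, 0 ≤ t ∧ support t ⊆ B ∧ g t = x) ↔ ∀ l ∈ L, 0 ≤ l x := by
  classical
  let Q : Submodule ℝ (V → ℝ) :=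
    { carrier := {t | support t ⊆ B}
      zero_mem' := by simp
      add_mem' := fun {a b} ha hb => (support_add a b).trans (union_subset ha hb)
      smul_mem' := fun c a ha => (support_const_smul_subset c a).trans ha }
  have hinj : LinearMap.ker (g.domRestrict Q) = ⊥ := by
    rw [LinearMap.ker_eq_bot]
    intro a b h
    exact Subtype.ext (injOn_span hg hB a.2 b.2 h)
  -- With a left inverse `ρ` of `g` on the span of the face, a point `x` lies in the image exactly
  -- when the coordinates of `ρ x` are nonnegative and `x = g (ρ x)`. Each coordinate of the latter
  -- equation is written as two opposite inequalities.
  obtain ⟨ρ, hρ⟩ := LinearMap.exists_leftInverse_of_injective _ hinj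
  have hρ' : ∀ t (ht : t ∈ Q), ρ (g t) = ⟨t, ht⟩ := fun t ht => LinearMap.congr_fun hρ ⟨t, ht⟩
  let b := Module.finBasis ℝ F
  let c : V → F →ₗ[ℝ] ℝ := fun v => LinearMap.proj v ∘ₗ Q.subtype ∘ₗ ρ
  let e := fun j => b.coord j ∘ₗ (LinearMap.id - g ∘ₗ Q.subtype ∘ₗ ρ)
  refine ⟨range c ∪ (range e ∪ range fun j => -e j), (finite_range _).union
    ((finite_range _).union (finite_range _)), fun x => ⟨?_, fun h => ?_⟩⟩
  · rintro ⟨t, h0, ht, rfl⟩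
    have hz : ∀ j, e j (g t) = 0 := fun j => by
      simp [e, hρ' t ht]
    rintro l (⟨v, rfl⟩ | ⟨j, rfl⟩ | ⟨j, rfl⟩)
    · simpa [c, hρ' t ht] using h0 v
    · exact (hz j).ge
    · simp [hz j]
  · refine ⟨ρ x, fun v => h (c v) (.inl ⟨v, rfl⟩), (ρ x).2, ?_⟩
    have hz : ∀ j, e j x = 0 := fun j =>
      le_antisymm (by simpa using h (-e j) (.inr (.inr ⟨j, rfl⟩))) (h (e j) (.inr (.inl ⟨j, rfl⟩)))
    have : x - g (ρ x) = 0 := b.ext_elem fun j => by simpa [e] using hz j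
    exact (sub_eq_zero.mp this).symm

/-- Two simplicial subdivisions of the same set have a common refinement. -/
theorem exists_common_refinement {V : Type} [Finite V] [Finite W] [FiniteDimensional ℝ F]
    {D : LowerSet (Set V)} {D' : LowerSet (Set W)} {f : (V → ℝ) →ₗ[ℝ] F} {g : (W → ℝ) →ₗ[ℝ] F}
    {T : Set F} (hf : BijOn f (cone D) T) (hg : BijOn g (cone D') T) :
    ∃ (V' : Type) (_ : Finite V') (D'' : LowerSet (Set V')) (r : (V' → ℝ) →ₗ[ℝ] (V → ℝ))
      (h : (V' → ℝ) →ₗ[ℝ] (W → ℝ)), BijOn r (cone D'') (cone D) ∧ BijOn h (cone D'') (cone D') := by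
  classical
  have hH : ∀ B : {B : Set W // B ∈ D'}, ∃ L : Set (F →ₗ[ℝ] ℝ), L.Finite ∧
      ∀ x, (∃ t, 0 ≤ t ∧ support t ⊆ B.1 ∧ g t = x) ↔ ∀ l ∈ L, 0 ≤ l x :=
    fun B => exists_halfSpaces hg.injOn B.2
  choose L hLfin hL using hH
  -- `D` is cut along the hyperplanes bounding the images of all faces of `D'`.
  obtain ⟨V', hfin, _, D'', r, hr, hsgn⟩ := exists_constSign_finset V D
    (L := (fun l => l ∘ₗ f) '' ⋃ B, L B) ((finite_iUnion hLfin).image _)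
  cases nonempty_fintype V'
  have hfr : BijOn (f ∘ₗ r) (cone D'') T := hf.comp hr
  -- the image of each face is contained in the image of a face of `D'`
  have hface : ∀ s ∈ D'', ∃ B ∈ D', ∀ i ∈ s,
      ∃ u, 0 ≤ u ∧ support u ⊆ B ∧ g u = f (r (Pi.single i 1)) := by
    intro s hs
    -- `B` is the face reached by the sum of the vertices of `s`. A defining functional of `B` is
    -- nonnegative at that sum and has constant sign on `s`; if it is nonpositive on all vertices of
    -- `s`, it must vanish on them.
    obtain ⟨u, hu, hgu⟩ := hg.surjOn (hfr.mapsTo (indicator_mem_cone hs))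
    refine ⟨support u, hu.2, fun i hi => (hL ⟨_, hu.2⟩ _).mpr fun l hl => ?_⟩
    have hpos : 0 ≤ l ((f ∘ₗ r) (s.indicator fun _ => 1)) :=
      (hL ⟨_, hu.2⟩ _).mp ⟨u, hu.1, subset_rfl, hgu⟩ l hl
    rcases hsgn (l ∘ₗ f) (mem_image_of_mem _ (mem_iUnion.mpr ⟨_, hl⟩)) s hs with h | h
    · exact h i hi
    · have e : l ((f ∘ₗ r) (s.indicator fun _ => 1)) =
          ∑ j, s.indicator (fun _ => (1 : ℝ)) j • l (f (r (Pi.single j 1))) :=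
        map_eq_sum_single (l ∘ₗ f ∘ₗ r) _
      have hnp : ∀ j ∈ Finset.univ,
          s.indicator (fun _ => (1 : ℝ)) j • l (f (r (Pi.single j 1))) ≤ 0 := by
        intro j _
        by_cases hj : j ∈ s
        · simpa [hj] using h j hj
        · simp [hj]
      have := (Finset.sum_eq_zero_iff_of_nonpos hnp).mp
        (le_antisymm (Finset.sum_nonpos hnp) (e ▸ hpos)) i (Finset.mem_univ i)
      simp only [hi, indicator_of_mem, one_smul] at this
      exact this.ge
  have hφ : ∀ i : V', ∃ u : W → ℝ, {i} ∈ D'' → u ∈ cone D' ∧ g u = f (r (Pi.single i 1)) := by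
    intro i
    by_cases hi : {i} ∈ D''
    · obtain ⟨u, hu, h⟩ := hg.surjOn (hfr.mapsTo (single_mem_cone hi zero_le_one))
      exact ⟨u, fun _ => ⟨hu, h⟩⟩
    · exact ⟨0, fun h => absurd h hi⟩
  choose φ hφ using hφ
  let h := Fintype.linearCombination ℝ φ
  have happ : ∀ t, h t = ∑ i, t i • φ i := fun t => Fintype.linearCombination_apply ℝ φ t
  have hmaps : ∀ t ∈ cone D'', h t ∈ cone D' := by
    intro t ht
    obtain ⟨B, hB, hBs⟩ := hface _ ht.2
    have key : ∀ i, t i ≠ 0 → 0 ≤ φ i ∧ support (φ i) ⊆ B := by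
      intro i hi
      obtain ⟨u, hu0, huB, hu⟩ := hBs i hi
      have h1 := hφ i (singleton_mem_of_mem ht.2 hi)
      have : φ i = u := hg.injOn h1.1 ⟨hu0, D'.lower huB hB⟩ (h1.2.trans hu.symm)
      exact this ▸ ⟨hu0, huB⟩
    refine ⟨?_, D'.lower ?_ hB⟩
    · rw [happ]
      refine Finset.sum_nonneg fun i _ => ?_
      by_cases hi : t i = 0
      · simp [hi]
      · exact smul_nonneg (ht.1 i) (key i hi).1
    · intro w hw
      rw [happ, mem_support, Finset.sum_apply] at hw
      obtain ⟨i, _, hi⟩ := Finset.exists_ne_zero_of_sum_ne_zero hw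
      have hi' : t i ≠ 0 ∧ φ i w ≠ 0 := by simpa using hi
      exact (key i hi'.1).2 hi'.2
  -- `h` is defined on vertices by lifting through `g`. By linearity it lifts the whole map, and
  -- this transfers bijectivity to `h`.
  have hcomm : ∀ t ∈ cone D'', g (h t) = (f ∘ₗ r) t := by
    intro t ht
    rw [happ, map_sum, map_eq_sum_single (f ∘ₗ r) t]
    refine Finset.sum_congr rfl fun i _ => ?_
    by_cases hi : t i = 0
    · simp [hi]
    · rw [map_smul, (hφ i (singleton_mem_of_mem ht.2 hi)).2]; rfl
  refine ⟨V', hfin, D'', r, h, hr, hmaps, fun t ht t' ht' e => ?_, fun u hu => ?_⟩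
  · exact hfr.injOn ht ht' (by rw [← hcomm t ht, ← hcomm t' ht', e])
  · obtain ⟨t, ht, e⟩ := hfr.surjOn (hg.mapsTo hu)
    exact ⟨t, ht, hg.injOn (hmaps t ht) hu ((hcomm t ht).trans e)⟩

/-- The two complexes parametrizing the middle set are replaced by a common refinement, which then
parametrizes the outer sets as well. -/
theorem PLEquiv.trans [FiniteDimensional ℝ F] {S : Set E} {T : Set F} {U : Set G}
    (h : PLEquiv S T) (h' : PLEquiv T U) : PLEquiv S U := by
  obtain ⟨m, D, f, g, hf, hg⟩ := h
  obtain ⟨m', D', f', g', hf', hg'⟩ := h'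
  obtain ⟨V, _, D'', r, s, hr, hs⟩ := exists_common_refinement hg hf'
  exact .of_bijOn (f := f ∘ₗ r) (g := g' ∘ₗ s) (hf.comp hr) (hg'.comp hs)

end Refinement

/-! ### Subdivisions and isomorphisms as linear bijections of cones -/

section Complexes

variable {V W : Type*}

/-- All faces of a complex, including the empty one, as a family of sets. -/
def faceSets (K : PreAbstractSimplicialComplex V) : LowerSet (Set V) where
  carrier := {s | s = ∅ ∨ ∃ A ∈ K.faces, (A : Set V) = s}
  lower' := by
    classical
    rintro s t hts (rfl | ⟨A, hA, rfl⟩)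
    · exact .inl (subset_empty_iff.mp hts)
    · rcases t.eq_empty_or_nonempty with h | h
      · exact .inl h
      · have hfin : t.Finite := A.finite_toSet.subset hts
        refine .inr ⟨hfin.toFinset, (K.isRelLowerSet_faces hA).2 ?_ ?_, by simp⟩
        · intro v hv; exact hts (hfin.mem_toFinset.mp hv)
        · simpa using h

theorem empty_mem_faceSets (K : PreAbstractSimplicialComplex V) : ∅ ∈ faceSets K := .inl rfl

theorem coe_mem_faceSets {K : PreAbstractSimplicialComplex V} {A : Finset V} (hA : A.Nonempty) :
    (A : Set V) ∈ faceSets K ↔ A ∈ K.faces := by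
  refine ⟨?_, fun h => .inr ⟨A, h, rfl⟩⟩
  rintro (h | ⟨B, hB, h⟩)
  · exact absurd (Finset.coe_eq_empty.mp h) hA.ne_empty
  · rwa [← Finset.coe_injective h]

theorem singleton_mem_faceSets {K : PreAbstractSimplicialComplex V} {v : V} :
    {v} ∈ faceSets K ↔ {v} ∈ K.faces := by
  rw [← coe_mem_faceSets (Finset.singleton_nonempty v), Finset.coe_singleton]

/-- The simplicial complex with a given family of faces. -/
def complexOf (D : LowerSet (Set V)) : PreAbstractSimplicialComplex V where
  faces := {A | A.Nonempty ∧ (A : Set V) ∈ D}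
  isRelLowerSet_faces := fun _ hA =>
    ⟨hA.1, fun _ hBA hB => ⟨hB, D.lower (Finset.coe_subset.mpr hBA) hA.2⟩⟩

theorem faceSets_complexOf [Finite V] {D : LowerSet (Set V)} (hD : ∅ ∈ D) :
    faceSets (complexOf D) = D := by
  ext s
  refine ⟨?_, fun hs => ?_⟩
  · rintro (rfl | ⟨A, hA, rfl⟩)
    exacts [hD, hA.2]
  · rcases s.eq_empty_or_nonempty with h | h
    · exact .inl h
    · exact .inr ⟨(toFinite s).toFinset, ⟨by simpa using h, by simpa using hs⟩, by simp⟩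

theorem mem_carrier_iff [Fintype V] {K : PreAbstractSimplicialComplex V} {t : V → ℝ} :
    t ∈ carrier K ↔ t ∈ cone (faceSets K) ∧ ∑ v, t v = 1 := by
  classical
  simp only [carrier, mem_iUnion, exists_prop, faceCarrier, mem_ofPred_eq]
  constructor
  · rintro ⟨A, hA, h0, hA0, h1⟩
    refine ⟨⟨h0, (faceSets K).lower (fun v hv => ?_) (.inr ⟨A, hA, rfl⟩)⟩, ?_⟩
    · by_contra h; exact hv (hA0 v h)
    · rw [← h1]
      exact (Finset.sum_subset (Finset.subset_univ A) fun v _ hv => hA0 v hv).symm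
  · rintro ⟨⟨h0, h | ⟨A, hA, hAt⟩⟩, h1⟩
    · rw [support_eq_empty_iff] at h
      simp [h] at h1
    · have hz : ∀ v, v ∉ A → t v = 0 := fun v hv => by
        by_contra h
        exact hv (by rw [← Finset.mem_coe, hAt]; exact h)
      refine ⟨A, hA, h0, hz, ?_⟩
      rw [← h1]
      exact Finset.sum_subset (Finset.subset_univ A) fun v _ hv => hz v hv

theorem smul_mem_cone {D : LowerSet (Set V)} {t : V → ℝ} (ht : t ∈ cone D) {c : ℝ} (hc : 0 ≤ c) :
    c • t ∈ cone D :=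
  ⟨smul_nonneg hc ht.1, D.lower (support_const_smul_subset c t) ht.2⟩

theorem sum_pos_of_mem_cone [Fintype V] {D : LowerSet (Set V)} {t : V → ℝ} (ht : t ∈ cone D)
    (h : t ≠ 0) : 0 < ∑ v, t v := by
  obtain ⟨v, hv⟩ := Function.ne_iff.mp h
  exact Finset.sum_pos' (fun v _ => ht.1 v) ⟨v, Finset.mem_univ v, lt_of_le_of_ne (ht.1 v) hv.symm⟩

theorem isCompact_carrier [Finite V] (K : PreAbstractSimplicialComplex V) :
    IsCompact (carrier K) := by
  cases nonempty_fintype V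
  refine (toFinite K.faces).isCompact_biUnion fun A _ => ?_
  refine (isCompact_Icc (a := (0 : V → ℝ)) (b := 1)).of_isClosed_subset ?_ ?_
  · simp only [faceCarrier, ofPred_and]
    refine IsClosed.inter ?_ (IsClosed.inter ?_ ?_)
    · simp only [ofPred_forall]
      exact isClosed_iInter fun v => isClosed_le continuous_const (continuous_apply v)
    · simp only [ofPred_forall]
      exact isClosed_iInter fun v => isClosed_iInter fun _ =>
        isClosed_eq (continuous_apply v) continuous_const
    · exact isClosed_eq (continuous_finsetSum _ fun v _ => continuous_apply v) continuous_const
  · rintro t ⟨h0, hA, h1⟩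
    refine ⟨h0, fun v => ?_⟩
    by_cases hv : v ∈ A
    · rw [Pi.one_apply, ← h1]
      exact Finset.single_le_sum (fun w _ => h0 w) hv
    · simp [hA v hv]

/-- A map that is affine on simplices is determined by the images of the vertices, and the linear
map with these values agrees with it on the carrier. Carriers consist of points with coordinate sum
one, so coordinate sums are preserved on cones, and bijectivity passes from carriers to cones by
rescaling. -/
theorem bijOn_cone_of_isSubdivision [Finite V] [Finite W] {K' : PreAbstractSimplicialComplex V}
    {K : PreAbstractSimplicialComplex W} (h : IsSubdivision K' K) :
    ∃ f : (V → ℝ) →ₗ[ℝ] (W → ℝ), BijOn f (cone (faceSets K')) (cone (faceSets K)) := by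
  classical
  cases nonempty_fintype V
  cases nonempty_fintype W
  obtain ⟨φ, hφ⟩ := h
  have hvert : ∀ v : V, ∃ p : W → ℝ, ∀ hv : Pi.single v (1 : ℝ) ∈ carrier K', p = (φ ⟨_, hv⟩).1 := by
    intro v
    by_cases hv : Pi.single v (1 : ℝ) ∈ carrier K'
    · exact ⟨(φ ⟨_, hv⟩).1, fun _ => rfl⟩
    · exact ⟨0, fun h => absurd h hv⟩
  choose p hp using hvert
  let f := Fintype.linearCombination ℝ p
  have happ : ∀ t, f t = ∑ v, t v • p v := fun t => Fintype.linearCombination_apply ℝ p t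
  have hf : ∀ x : carrier K', f x.1 = (φ x).1 := by
    intro x
    obtain ⟨A, hA, hx⟩ := mem_iUnion₂.mp x.2
    obtain ⟨g, hg⟩ := hφ A hA
    have hA1 : ∀ v ∈ A, p v = g (Pi.single v 1) := by
      intro v hv
      have hm : Pi.single v (1 : ℝ) ∈ faceCarrier A :=
        ⟨fun w => by by_cases h : w = v <;> simp [h],
          fun w hw => by simp [show w ≠ v from fun h => hw (h ▸ hv)],
          by simp [Pi.single_apply, hv]⟩
      have hm' : Pi.single v (1 : ℝ) ∈ carrier K' := mem_iUnion₂.mpr ⟨A, hA, hm⟩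
      rw [hp v hm', hg ⟨_, hm'⟩ hm]
    have hsum : ∑ v, x.1 v = 1 := (mem_carrier_iff.mp x.2).2
    have hdec : ∀ y, g y = g.linear y + g 0 := fun y => congrFun g.decomp y
    rw [happ, hg x hx, hdec, map_eq_sum_single g.linear]
    have : g 0 = ∑ v, x.1 v • g 0 := by rw [← Finset.sum_smul, hsum, one_smul]
    rw [this, ← Finset.sum_add_distrib]
    refine Finset.sum_congr rfl fun v _ => ?_
    by_cases hv : v ∈ A
    · rw [hA1 v hv, hdec (Pi.single v 1), smul_add]
    · simp [hx.2.1 v hv]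
  have hnorm : ∀ t ∈ cone (faceSets K'), t ≠ 0 → ∃ (c : ℝ) (x : carrier K'), 0 < c ∧ t = c • x.1 ∧
      f t = c • (φ x).1 := by
    intro t ht h
    have hpos := sum_pos_of_mem_cone ht h
    have hmem : (∑ v, t v)⁻¹ • t ∈ carrier K' :=
      mem_carrier_iff.mpr ⟨smul_mem_cone ht (inv_nonneg.mpr hpos.le), by
        simp only [Pi.smul_apply, smul_eq_mul, ← Finset.mul_sum]
        exact inv_mul_cancel₀ hpos.ne'⟩
    have e : t = (∑ v, t v) • (∑ v, t v)⁻¹ • t := by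
      rw [smul_smul, mul_inv_cancel₀ hpos.ne', one_smul]
    refine ⟨_, ⟨_, hmem⟩, hpos, e, ?_⟩
    rw [← hf, ← map_smul, ← e]
  have hmaps : MapsTo f (cone (faceSets K')) (cone (faceSets K)) := by
    intro t ht
    by_cases h : t = 0
    · rw [h, map_zero]
      exact ⟨le_rfl, by rw [support_zero]; exact empty_mem_faceSets K⟩
    · obtain ⟨c, x, hc, -, hfx⟩ := hnorm t ht h
      rw [hfx]
      exact smul_mem_cone (mem_carrier_iff.mp (φ x).2).1 hc.le
  have hsumf : ∀ t ∈ cone (faceSets K'), ∑ w, f t w = ∑ v, t v := by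
    intro t ht
    by_cases h : t = 0
    · simp [h]
    · obtain ⟨c, x, hc, htx, hfx⟩ := hnorm t ht h
      rw [hfx, htx]
      simp only [Pi.smul_apply, smul_eq_mul, ← Finset.mul_sum]
      rw [(mem_carrier_iff.mp (φ x).2).2, (mem_carrier_iff.mp x.2).2]
  refine ⟨f, hmaps, fun t ht t' ht' e => ?_, fun s hs => ?_⟩
  · have hs : ∑ v, t v = ∑ v, t' v := by rw [← hsumf t ht, ← hsumf t' ht', e]
    by_cases h : t = 0
    · by_contra h'
      have := sum_pos_of_mem_cone ht' (fun h2 => h' (h.trans h2.symm))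
      rw [← hs, h] at this
      simp at this
    · have h' : t' ≠ 0 := by
        rintro rfl
        have := sum_pos_of_mem_cone ht h
        rw [hs] at this
        simp at this
      obtain ⟨c, x, hc, htx, hfx⟩ := hnorm t ht h
      obtain ⟨c', x', hc', htx', hfx'⟩ := hnorm t' ht' h'
      have hcc : c = c' := by
        have e1 : ∑ v, t v = c := by
          rw [htx]; simp only [Pi.smul_apply, smul_eq_mul, ← Finset.mul_sum]
          rw [(mem_carrier_iff.mp x.2).2, mul_one]
        have e2 : ∑ v, t' v = c' := by
          rw [htx']; simp only [Pi.smul_apply, smul_eq_mul, ← Finset.mul_sum]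
          rw [(mem_carrier_iff.mp x'.2).2, mul_one]
        rw [← e1, ← e2, hs]
      subst hcc
      have h3 : (φ x).1 = (φ x').1 := by
        rw [hfx, hfx'] at e
        exact smul_right_injective _ hc.ne' e
      have h4 : x = x' := φ.injective (Subtype.ext h3)
      rw [htx, htx', h4]
  · by_cases h : s = 0
    · exact ⟨0, ⟨le_rfl, by rw [support_zero]; exact empty_mem_faceSets K'⟩, by rw [map_zero, h]⟩
    · have hpos := sum_pos_of_mem_cone hs h
      have hmem : (∑ w, s w)⁻¹ • s ∈ carrier K :=
        mem_carrier_iff.mpr ⟨smul_mem_cone hs (inv_nonneg.mpr hpos.le), by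
          simp only [Pi.smul_apply, smul_eq_mul, ← Finset.mul_sum]
          exact inv_mul_cancel₀ hpos.ne'⟩
      refine ⟨(∑ w, s w) • (φ.symm ⟨_, hmem⟩).1,
        smul_mem_cone (mem_carrier_iff.mp (φ.symm ⟨_, hmem⟩).2).1 hpos.le, ?_⟩
      rw [map_smul, hf, φ.apply_symm_apply, smul_smul, mul_inv_cancel₀ hpos.ne', one_smul]

/-- A linear bijection of cones need not preserve coordinate sums. Dividing the coordinate at each
vertex `v` by the coordinate sum `c v > 0` of its image corrects this without changing any face; the
resulting continuous bijection of carriers is a homeomorphism by compactness. -/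
theorem isSubdivision_of_bijOn_cone [Finite V] [Finite W] {K' : PreAbstractSimplicialComplex V}
    {K : PreAbstractSimplicialComplex W} {f : (V → ℝ) →ₗ[ℝ] (W → ℝ)}
    (hf : BijOn f (cone (faceSets K')) (cone (faceSets K))) : IsSubdivision K' K := by
  classical
  cases nonempty_fintype V
  cases nonempty_fintype W
  let c : V → ℝ := fun v => ∑ w, f (Pi.single v 1) w
  have hc : ∀ v, {v} ∈ faceSets K' → 0 < c v := by
    intro v hv
    have h1 := single_mem_cone hv zero_le_one
    have h0 : (0 : V → ℝ) ∈ cone (faceSets K') :=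
      ⟨le_rfl, by rw [support_zero]; exact empty_mem_faceSets K'⟩
    refine sum_pos_of_mem_cone (hf.mapsTo h1) fun h => ?_
    have := congrFun (hf.injOn h1 h0 (by rw [h, map_zero])) v
    simp at this
  let sc : (V → ℝ) →ₗ[ℝ] (V → ℝ) := LinearMap.pi fun v => (c v)⁻¹ • LinearMap.proj v
  have hsc : ∀ t v, sc t v = (c v)⁻¹ * t v := fun t v => rfl
  have hcv : ∀ t ∈ cone (faceSets K'), ∀ v, t v ≠ 0 → 0 < c v := fun t ht v hv =>
    hc v (singleton_mem_of_mem ht.2 hv)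
  have hscb : BijOn sc (cone (faceSets K')) (cone (faceSets K')) := by
    refine ⟨fun t ht => ⟨fun v => ?_, (faceSets K').lower ?_ ht.2⟩, fun t ht t' ht' e => ?_,
      fun t ht => ⟨fun v => c v * t v, ⟨fun v => ?_, (faceSets K').lower ?_ ht.2⟩, ?_⟩⟩
    · rw [hsc]
      by_cases h : t v = 0
      · simp [h]
      · exact mul_nonneg (inv_nonneg.mpr (hcv t ht v h).le) (ht.1 v)
    · intro v hv h; exact hv (by rw [hsc, h, mul_zero])
    · ext v
      have h2 := congrFun e v
      rw [hsc, hsc] at h2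
      by_cases h : t v = 0
      · by_cases h' : t' v = 0
        · rw [h, h']
        · exact mul_left_cancel₀ (inv_ne_zero (hcv t' ht' v h').ne') h2
      · exact mul_left_cancel₀ (inv_ne_zero (hcv t ht v h).ne') h2
    · by_cases h : t v = 0
      · simp [h]
      · exact mul_nonneg (hcv t ht v h).le (ht.1 v)
    · intro v hv h; exact hv (by simp [h])
    · ext v
      rw [hsc]
      by_cases h : t v = 0
      · simp [h]
      · exact inv_mul_cancel_left₀ (hcv t ht v h).ne' _
  have hsum : ∀ t ∈ cone (faceSets K'), ∑ w, f (sc t) w = ∑ v, t v := by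
    intro t ht
    rw [map_eq_sum_single f]
    simp only [Finset.sum_apply, Pi.smul_apply, smul_eq_mul]
    rw [Finset.sum_comm]
    refine Finset.sum_congr rfl fun v _ => ?_
    rw [← Finset.mul_sum, hsc]
    change (c v)⁻¹ * t v * c v = t v
    by_cases h : t v = 0
    · simp [h]
    · have := (hcv t ht v h).ne'
      field_simp
  have hbij : BijOn (f ∘ₗ sc) (carrier K') (carrier K) := by
    have hb : BijOn (f ∘ₗ sc) (cone (faceSets K')) (cone (faceSets K)) := hf.comp hscb
    refine ⟨fun t ht => ?_, fun t ht t' ht' e => ?_, fun s hs => ?_⟩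
    · rw [mem_carrier_iff] at ht ⊢
      exact ⟨hb.mapsTo ht.1, (hsum t ht.1).trans ht.2⟩
    · exact hb.injOn (mem_carrier_iff.mp ht).1 (mem_carrier_iff.mp ht').1 e
    · rw [mem_carrier_iff] at hs
      obtain ⟨t, ht, rfl⟩ := hb.surjOn hs.1
      exact ⟨t, mem_carrier_iff.mpr ⟨ht, (hsum t ht).symm.trans hs.2⟩, rfl⟩
  have : CompactSpace (carrier K') := isCompact_iff_compactSpace.mp (isCompact_carrier K')
  have hcont : Continuous (hbij.equiv (f ∘ₗ sc)) := by
    refine Continuous.subtype_mk ?_ _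
    exact (LinearMap.continuous_of_finiteDimensional (f ∘ₗ sc)).comp continuous_subtype_val
  exact ⟨hcont.homeoOfEquivCompactToT2, fun A _ => ⟨(f ∘ₗ sc).toAffineMap, fun x _ => rfl⟩⟩

/-- Vertices are the minimal nonempty faces, so an order isomorphism must preserve them. -/
theorem Isomorphic.exists_singleton {K : PreAbstractSimplicialComplex V}
    {L : PreAbstractSimplicialComplex W} (φ : K.faces ≃o L.faces) {v : V} (hv : {v} ∈ K.faces) :
    ∃ w, (φ ⟨{v}, hv⟩).1 = {w} := by
  obtain ⟨w, hw⟩ := (L.isRelLowerSet_faces (φ ⟨{v}, hv⟩).2).1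
  have hwL : {w} ∈ L.faces := (L.isRelLowerSet_faces (φ ⟨{v}, hv⟩).2).2
    (Finset.singleton_subset_iff.mpr hw) (Finset.singleton_nonempty w)
  have hle : (⟨{w}, hwL⟩ : L.faces) ≤ φ ⟨{v}, hv⟩ := Finset.singleton_subset_iff.mpr hw
  have h1 : φ.symm ⟨{w}, hwL⟩ ≤ ⟨{v}, hv⟩ := (φ.symm_apply_le).mpr hle
  have h2 : φ.symm ⟨{w}, hwL⟩ = ⟨{v}, hv⟩ := Subtype.ext
    ((Finset.subset_singleton_iff.mp h1).resolve_left
      (K.isRelLowerSet_faces (φ.symm ⟨{w}, hwL⟩).2).1.ne_empty)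
  exact ⟨w, by rw [← h2, φ.apply_symm_apply]⟩

open Classical in
/-- The linear map given by the vertex map of an isomorphism. -/
noncomputable def isoMap {K : PreAbstractSimplicialComplex V} {L : PreAbstractSimplicialComplex W}
    (φ : K.faces ≃o L.faces) : (W → ℝ) →ₗ[ℝ] (V → ℝ) :=
  LinearMap.pi fun v =>
    if hv : {v} ∈ K.faces then LinearMap.proj (Isomorphic.exists_singleton φ hv).choose else 0

theorem isoMap_apply {K : PreAbstractSimplicialComplex V} {L : PreAbstractSimplicialComplex W}
    (φ : K.faces ≃o L.faces) {v : V} (hv : {v} ∈ K.faces) {w : W} (hw : (φ ⟨{v}, hv⟩).1 = {w})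
    (t : W → ℝ) : isoMap φ t v = t w := by
  have h := hw.symm.trans (Isomorphic.exists_singleton φ hv).choose_spec
  simp only [isoMap, LinearMap.pi_apply, hv, dite_true, LinearMap.proj_apply]
  rw [← Finset.singleton_injective h]

theorem isoMap_apply_of_notMem {K : PreAbstractSimplicialComplex V}
    {L : PreAbstractSimplicialComplex W} (φ : K.faces ≃o L.faces) {v : V} (hv : {v} ∉ K.faces)
    (t : W → ℝ) : isoMap φ t v = 0 := by
  simp [isoMap, hv]

theorem mapsTo_isoMap {K : PreAbstractSimplicialComplex V} {L : PreAbstractSimplicialComplex W}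
    (φ : K.faces ≃o L.faces) :
    MapsTo (isoMap φ) (cone (faceSets L)) (cone (faceSets K)) := by
  intro t ht
  refine ⟨fun v => ?_, ?_⟩
  · by_cases hv : {v} ∈ K.faces
    · obtain ⟨w, hw⟩ := Isomorphic.exists_singleton φ hv
      rw [isoMap_apply φ hv hw]; exact ht.1 w
    · rw [isoMap_apply_of_notMem φ hv]; rfl
  · rcases ht.2 with h | ⟨B, hB, hBt⟩
    · rw [support_eq_empty_iff] at h
      rw [h, map_zero, support_zero]
      exact empty_mem_faceSets K
    · refine (faceSets K).lower ?_ (.inr ⟨_, (φ.symm ⟨B, hB⟩).2, rfl⟩)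
      intro v hv
      have hvK : {v} ∈ K.faces := by
        by_contra h; exact hv (isoMap_apply_of_notMem φ h t)
      obtain ⟨w, hw⟩ := Isomorphic.exists_singleton φ hvK
      rw [mem_support, isoMap_apply φ hvK hw, ← mem_support, ← hBt] at hv
      have : φ ⟨{v}, hvK⟩ ≤ ⟨B, hB⟩ := by
        change (φ ⟨{v}, hvK⟩).1 ⊆ B
        rw [hw]; exact Finset.singleton_subset_iff.mpr hv
      exact Finset.singleton_subset_iff.mp ((φ.le_symm_apply).mpr this)

theorem isoMap_isoMap_symm {K : PreAbstractSimplicialComplex V}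
    {L : PreAbstractSimplicialComplex W} (φ : K.faces ≃o L.faces) {t : V → ℝ}
    (ht : t ∈ cone (faceSets K)) : isoMap φ (isoMap φ.symm t) = t := by
  ext v
  by_cases hv : {v} ∈ K.faces
  · obtain ⟨w, hw⟩ := Isomorphic.exists_singleton φ hv
    have hwL : {w} ∈ L.faces := hw ▸ (φ ⟨{v}, hv⟩).2
    rw [isoMap_apply φ hv hw, isoMap_apply φ.symm hwL (w := v)]
    have : (⟨{w}, hwL⟩ : L.faces) = φ ⟨{v}, hv⟩ := Subtype.ext hw.symm
    rw [this, φ.symm_apply_apply]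
  · rw [isoMap_apply_of_notMem φ hv]
    by_contra h
    exact hv (singleton_mem_faceSets.mp (singleton_mem_of_mem ht.2 (Ne.symm h)))

theorem bijOn_isoMap {K : PreAbstractSimplicialComplex V} {L : PreAbstractSimplicialComplex W}
    (φ : K.faces ≃o L.faces) : BijOn (isoMap φ) (cone (faceSets L)) (cone (faceSets K)) :=
  InvOn.bijOn (f' := isoMap φ.symm)
    ⟨fun _ ht => isoMap_isoMap_symm φ.symm ht, fun _ ht => isoMap_isoMap_symm φ ht⟩
    (mapsTo_isoMap φ) (mapsTo_isoMap φ.symm)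

/-- Combinatorial equivalence is piecewise linear equivalence of the cones. -/
theorem combEquiv_iff [Finite V] [Finite W] {K : PreAbstractSimplicialComplex V}
    {L : PreAbstractSimplicialComplex W} :
    CombEquiv K L ↔ PLEquiv (cone (faceSets K)) (cone (faceSets L)) := by
  constructor
  · rintro ⟨m, n, K', L', hK, hL, ⟨φ⟩⟩
    obtain ⟨f, hf⟩ := bijOn_cone_of_isSubdivision hK
    obtain ⟨g, hg⟩ := bijOn_cone_of_isSubdivision hL
    exact ⟨n, faceSets L', f ∘ₗ isoMap φ, g, hf.comp (bijOn_isoMap φ), hg⟩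
  · rintro ⟨m, D, f, g, hf, hg⟩
    have hD : ∅ ∈ D := by
      have h0 : (0 : V → ℝ) ∈ cone (faceSets K) :=
        ⟨le_rfl, by rw [support_zero]; exact empty_mem_faceSets K⟩
      obtain ⟨t, ht, -⟩ := hf.surjOn h0
      exact D.lower (empty_subset _) ht.2
    rw [← faceSets_complexOf hD] at hf hg
    exact ⟨m, m, complexOf D, complexOf D, isSubdivision_of_bijOn_cone hf,
      isSubdivision_of_bijOn_cone hg, ⟨OrderIso.refl _⟩⟩

/-! ### Spheres as complexes whose cone is a vector space -/

section Spheres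

variable {E F G : Type*} [AddCommGroup E] [Module ℝ E] [AddCommGroup F] [Module ℝ F]
  [FiniteDimensional ℝ F] [AddCommGroup G] [Module ℝ G] [FiniteDimensional ℝ G]

theorem PLEquiv.univ_congr {S : Set E} (h : PLEquiv S (univ : Set F))
    (hFG : Module.finrank ℝ F = Module.finrank ℝ G) : PLEquiv S (univ : Set G) :=
  h.map (f := (LinearEquiv.ofFinrankEq F G hFG).toLinearMap)
    (bijOn_univ.mpr (LinearEquiv.ofFinrankEq F G hFG).bijective)

/-- The cone over the boundary of a simplex is piecewise linearly equivalent to a vector space. -/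
theorem PLEquiv.boundary_simplex [Finite V] [Nonempty V] {D : LowerSet (Set V)}
    (hD : ∀ s, s ∈ D ↔ s ≠ univ) (hF : Module.finrank ℝ F + 1 = Nat.card V) :
    PLEquiv (cone D) (univ : Set F) := by
  classical
  cases nonempty_fintype V
  obtain ⟨v₀⟩ := ‹Nonempty V›
  let f : (V → ℝ) →ₗ[ℝ] ({v // v ≠ v₀} → ℝ) :=
    LinearMap.pi fun v =>
      LinearMap.proj (R := ℝ) (φ := fun _ : V => ℝ) v.1 - LinearMap.proj v₀
  have hf : ∀ t v, f t v = t v.1 - t v₀ := fun t v => rfl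
  -- `f` divides out the constant vectors. Each class contains exactly one nonnegative vector with a
  -- vanishing coordinate, obtained by subtracting the minimum.
  have hb : BijOn f (cone D) univ := by
    refine ⟨mapsTo_univ _ _, ?_, fun y _ => ?_⟩
    · have key : ∀ t ∈ cone D, ∀ t' ∈ cone D, f t = f t' → t v₀ ≤ t' v₀ := by
        intro t ht t' ht' e
        by_contra! hlt
        refine (hD _).mp ht.2 (eq_univ_of_forall fun v => ?_)
        by_cases hv : v = v₀
        · rw [mem_support, hv]; exact ((ht'.1 v₀).trans_lt hlt).ne'
        · have h1 := congrFun e ⟨v, hv⟩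
          rw [hf, hf] at h1
          have h2 := ht'.1 v
          simp only [Pi.zero_apply] at h2
          simp only at h1
          exact (show 0 < t v by linarith).ne'
      intro t ht t' ht' e
      have h0 := le_antisymm (key t ht t' ht' e) (key t' ht' t ht e.symm)
      ext v
      by_cases hv : v = v₀
      · rw [hv, h0]
      · have h1 := congrFun e ⟨v, hv⟩
        rw [hf, hf, h0] at h1
        exact sub_left_injective h1
    · let Y : V → ℝ := fun v => if h : v ≠ v₀ then y ⟨v, h⟩ else 0
      have : Nonempty V := ⟨v₀⟩
      obtain ⟨m, hm⟩ := Finite.exists_min Y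
      refine ⟨fun v => Y v - Y m, ⟨fun v => sub_nonneg.mpr (hm v), (hD _).mpr fun h => ?_⟩, ?_⟩
      · have : m ∈ support fun v => Y v - Y m := h ▸ mem_univ m
        simp at this
      · ext ⟨v, hv⟩
        rw [hf]
        simp [Y, hv]
  refine (PLEquiv.of_cone hb).univ_congr ?_
  rw [Module.finrank_fintype_fun_eq_card, Fintype.card_subtype_compl, Fintype.card_subtype_eq,
    ← Nat.card_eq_fintype_card]
  omega

/-- The standard sphere is the boundary of a simplex, so comparison with it may be replaced by
comparison with a vector space. The bound `-1 ≤ d` follows from `hF`. -/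
theorem isCombinatorialSphere_iff [Finite V] {d : ℤ} {K : PreAbstractSimplicialComplex V}
    (hF : (Module.finrank ℝ F : ℤ) = d + 1) :
    IsCombinatorialSphere d K ↔ PLEquiv (cone (faceSets K)) (univ : Set F) := by
  have : Nonempty (Fin (d + 2).toNat) := ⟨⟨0, by omega⟩⟩
  have hstd : PLEquiv (cone (faceSets (stdSphere d))) (univ : Set F) := by
    refine PLEquiv.boundary_simplex (fun s => ⟨?_, fun hs => ?_⟩) ?_
    · rintro (rfl | ⟨A, hA, rfl⟩)
      · exact empty_ne_univ
      · exact fun h => hA.2 (Finset.coe_eq_univ.mp h)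
    · classical
      rcases s.eq_empty_or_nonempty with h | h
      · exact .inl h
      · refine .inr ⟨(toFinite s).toFinset, ⟨by simpa using h, fun h' => hs ?_⟩, by simp⟩
        simpa using h'
    · rw [Nat.card_eq_fintype_card, Fintype.card_fin]; omega
  constructor
  · rintro ⟨-, h⟩
    exact (combEquiv_iff.mp h).trans hstd
  · intro h
    exact ⟨by omega, combEquiv_iff.mpr (h.trans hstd.symm)⟩

end Spheres

end Complexes

open Filter

/-! ### Links of vertices as tangent cones -/

section Links

variable {V W E F G : Type*} [AddCommGroup E] [Module ℝ E] [AddCommGroup F] [Module ℝ F]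
  [AddCommGroup G] [Module ℝ G]

/-- The link of a vertex. -/
def linkFaces (D : LowerSet (Set V)) (w : V) : LowerSet (Set V) where
  carrier := {s | w ∉ s ∧ insert w s ∈ D}
  lower' := fun _ _ hts hs => ⟨fun h => hs.1 (hts h), D.lower (insert_subset_insert hts) hs.2⟩

theorem faceSets_link {K : PreAbstractSimplicialComplex V} {x : V} (hx : {x} ∈ K.faces) :
    faceSets (link K x) = linkFaces (faceSets K) x := by
  classical
  ext s
  constructor
  · rintro (rfl | ⟨A, ⟨-, B, hB, hxB, rfl⟩, rfl⟩)
    · exact ⟨notMem_empty x, by rw [insert_empty_eq]; exact singleton_mem_faceSets.mpr hx⟩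
    · refine ⟨by simp, .inr ⟨B, hB, ?_⟩⟩
      ext y
      by_cases h : y = x <;> simp [h, hxB]
  · rintro ⟨hxs, h | ⟨B, hB, hBs⟩⟩
    · exact absurd h (insert_nonempty x s).ne_empty
    · rcases s.eq_empty_or_nonempty with h | h
      · exact .inl h
      · have hs : ((B.erase x : Finset V) : Set V) = s := by
          rw [Finset.coe_erase, hBs, insert_sdiff_of_mem _ (mem_singleton x),
            sdiff_singleton_eq_self hxs]
        refine .inr ⟨B.erase x, ⟨?_, B, hB, ?_, ?_⟩, hs⟩
        · rw [← Finset.coe_nonempty, hs]; exact h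
        · rw [← Finset.mem_coe, hBs]; exact mem_insert x s
        · congr!

theorem mem_cone_linkFaces {D : LowerSet (Set V)} {w : V} {t : V → ℝ} :
    t ∈ cone (linkFaces D w) ↔ 0 ≤ t ∧ t w = 0 ∧ insert w (support t) ∈ D := by
  change _ ∧ _ ∧ _ ↔ _
  simp

/-- The cone over the link of a vertex `w` parametrizes the tangent cone at (the image of) `w` modulo
the direction of `w`. -/
theorem bijOn_linkFaces [Finite V] [DecidableEq V] {D : LowerSet (Set V)} {f : (V → ℝ) →ₗ[ℝ] F}
    {S : Set F} (hf : BijOn f (cone D) S) {w : V} (hw : {w} ∈ D) {π : F →ₗ[ℝ] G}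
    (hker : LinearMap.ker π = ℝ ∙ f (Pi.single w 1)) {R : Set G}
    (hR : ∀ y, π y ∈ R ↔ ∀ᶠ c : ℝ in atTop, y + c • f (Pi.single w 1) ∈ S)
    (hrange : R ⊆ range π) : BijOn (π ∘ₗ f) (cone (linkFaces D w)) R := by
  set p := f (Pi.single w 1) with hp
  have hπp : π p = 0 := by
    rw [← LinearMap.mem_ker, hker]; exact Submodule.mem_span_singleton_self p
  have hadd : ∀ t ∈ cone (linkFaces D w), ∀ c : ℝ, 0 ≤ c → t + c • Pi.single w 1 ∈ cone D := by
    intro t ht c hc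
    rw [mem_cone_linkFaces] at ht
    refine ⟨add_nonneg ht.1 (smul_nonneg hc (Pi.single_nonneg.mpr zero_le_one)), D.lower ?_ ht.2.2⟩
    intro v hv
    by_cases h : v = w
    · exact .inl h
    · exact .inr (by simpa [h] using hv)
  refine ⟨fun t ht => (hR _).mpr ?_, ?_, fun r hr => ?_⟩
  · filter_upwards [eventually_ge_atTop 0] with c hc
    rw [hp, ← map_smul, ← map_add]
    exact hf.mapsTo (hadd t ht c hc)
  · have key : ∀ t ∈ cone (linkFaces D w), ∀ t' ∈ cone (linkFaces D w), ∀ c : ℝ, 0 ≤ c →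
        f t = f t' + c • p → t = t' := by
      intro t ht t' ht' c hc e
      rw [hp, ← map_smul, ← map_add] at e
      have h0 := hadd t ht 0 le_rfl
      rw [zero_smul, add_zero] at h0
      have h1 := hf.injOn h0 (hadd t' ht' c hc) e
      have h2 := congrFun h1 w
      simp [(mem_cone_linkFaces.mp ht).2.1, (mem_cone_linkFaces.mp ht').2.1] at h2
      simpa [← h2] using h1
    intro t ht t' ht' e
    have hmem : f t - f t' ∈ LinearMap.ker π := by
      rw [LinearMap.mem_ker, map_sub]; exact sub_eq_zero.mpr e
    rw [hker, Submodule.mem_span_singleton] at hmem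
    obtain ⟨c, hc⟩ := hmem
    rcases le_total 0 c with h | h
    · exact key t ht t' ht' c h (by rw [hc]; abel)
    · exact (key t' ht' t ht (-c) (neg_nonneg.mpr h) (by rw [neg_smul, hc]; abel)).symm
  · obtain ⟨y, rfl⟩ := hrange hr
    have hev := (hR y).mp hr
    have hx : ∀ c : ℝ, ∃ x : V → ℝ, y + c • p ∈ S → x ∈ cone D ∧ f x = y + c • p := by
      intro c
      by_cases h : y + c • p ∈ S
      · obtain ⟨x, hx, e⟩ := hf.surjOn h
        exact ⟨x, fun _ => ⟨hx, e⟩⟩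
      · exact ⟨0, fun h' => absurd h' h⟩
    choose x hx using hx
    -- There are only finitely many supports, so one of them recurs for arbitrarily large `c`.
    have hfreq : ∃ A : Set V, ∃ᶠ c : ℝ in atTop, support (x c) = A := by
      by_contra! h
      obtain ⟨c, hc⟩ := (eventually_all.mpr h).exists
      exact hc _ rfl
    obtain ⟨A, hA⟩ := hfreq
    have hfr := hA.and_eventually hev
    obtain ⟨c₁, hsup₁, hS₁⟩ := hfr.exists
    obtain ⟨hx₁, hfx₁⟩ := hx c₁ hS₁
    have hAD : A ∈ D := hsup₁ ▸ hx₁.2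
    obtain ⟨c₂, ⟨hsup₂, hS₂⟩, h12⟩ := (hfr.and_eventually (eventually_gt_atTop c₁)).exists
    obtain ⟨-, hfx₂⟩ := hx c₂ hS₂
    -- The preimages with support `A` move along a line with direction `z`, and `f z = p`. A
    -- negative coordinate of `z` would eventually make them leave the cone, so `z` lies in the cone
    -- and must be the vertex `w`; in particular `w ∈ A`.
    set z : V → ℝ := (c₂ - c₁)⁻¹ • (x c₂ - x c₁) with hz
    have hd : c₂ - c₁ ≠ 0 := (sub_pos.mpr h12).ne'
    have hoff : ∀ v, v ∉ A → x c₁ v = 0 ∧ z v = 0 := by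
      intro v hv
      have h1 : x c₁ v = 0 := by by_contra h; exact hv (hsup₁ ▸ h)
      have h2 : x c₂ v = 0 := by by_contra h; exact hv (hsup₂ ▸ h)
      simp [hz, h1, h2]
    have hfz : f z = p := by
      rw [hz, map_smul, map_sub, hfx₁, hfx₂, add_sub_add_left_eq_sub, ← sub_smul, smul_smul,
        inv_mul_cancel₀ hd, one_smul]
    have hz0 : 0 ≤ z := by
      intro v
      by_contra! hneg
      simp only [Pi.zero_apply] at hneg
      obtain ⟨c, ⟨hsup, hS⟩, hc⟩ :=
        (hfr.and_eventually (eventually_gt_atTop (c₁ + x c₁ v / (-z v)))).exists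
      obtain ⟨hxc, hfxc⟩ := hx c hS
      have e : x c = x c₁ + (c - c₁) • z := by
        refine injOn_span hf.injOn hAD hsup.le (fun u hu => ?_) ?_
        · by_contra h
          exact hu (by simp [hoff u h])
        · rw [hfxc, map_add, map_smul, hfz, hfx₁, sub_smul]; abel
      have h1 := hxc.1 v
      rw [e] at h1
      simp only [Pi.zero_apply, Pi.add_apply, Pi.smul_apply, smul_eq_mul] at h1
      have h2 : x c₁ v / (-z v) < c - c₁ := by linarith
      rw [div_lt_iff₀ (neg_pos.mpr hneg)] at h2
      linarith
    have hzw : z = Pi.single w 1 := by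
      refine hf.injOn ⟨hz0, D.lower (fun u hu => ?_) hAD⟩ (single_mem_cone hw zero_le_one) hfz
      by_contra h
      exact hu (hoff u h).2
    have hwA : w ∈ A := by
      by_contra h
      have := (hoff w h).2
      simp [hzw] at this
    refine ⟨update (x c₁) w 0, mem_cone_linkFaces.mpr ⟨fun v => ?_, by simp, D.lower ?_ hAD⟩, ?_⟩
    · by_cases h : v = w
      · simp [h]
      · simpa [h] using hx₁.1 v
    · refine insert_subset hwA fun v hv => ?_
      by_cases h : v = w
      · exact h ▸ hwA
      · rw [mem_support, update_of_ne h] at hv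
        exact hsup₁ ▸ hv
    · have e : update (x c₁) w 0 = x c₁ - x c₁ w • Pi.single w 1 := by
        ext v
        by_cases h : v = w
        · subst h; simp
        · simp [h]
      rw [e, LinearMap.comp_apply, map_sub, map_smul, map_sub, map_smul, ← hp, hπp, hfx₁, map_add,
        map_smul, hπp]
      simp

/-- The projection forgetting the coordinate `v`. -/
def forgetCoord [DecidableEq V] (v : V) : (V → ℝ) →ₗ[ℝ] (V → ℝ) :=
  LinearMap.id - (LinearMap.proj v).smulRight (Pi.single v 1)

theorem forgetCoord_apply_same [DecidableEq V] (v : V) (t : V → ℝ) : forgetCoord v t v = 0 := by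
  simp [forgetCoord]

theorem forgetCoord_apply_of_ne [DecidableEq V] {v u : V} (h : u ≠ v) (t : V → ℝ) :
    forgetCoord v t u = t u := by
  simp [forgetCoord, h]

theorem ker_forgetCoord [DecidableEq V] (v : V) :
    LinearMap.ker (forgetCoord v) = ℝ ∙ Pi.single v (1 : ℝ) := by
  ext t
  rw [LinearMap.mem_ker, Submodule.mem_span_singleton]
  constructor
  · intro h
    refine ⟨t v, ?_⟩
    ext u
    by_cases hu : u = v
    · subst hu; simp
    · simpa [hu, forgetCoord_apply_of_ne hu] using (congrFun h u).symm
  · rintro ⟨c, rfl⟩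
    ext u
    by_cases hu : u = v
    · subst hu; rw [forgetCoord_apply_same]; rfl
    · simp [forgetCoord_apply_of_ne hu, hu]

/-- Once `c` is large the coordinate at `v` is positive, so the support is that of the projection
with `v` added. -/
theorem forgetCoord_mem_cone_linkFaces [DecidableEq V] {D : LowerSet (Set V)} {v : V} {a : ℝ}
    (ha : 0 < a) (y : V → ℝ) : forgetCoord v y ∈ cone (linkFaces D v) ↔
      ∀ᶠ c : ℝ in atTop, y + c • Pi.single v a ∈ cone D := by
  have hlarge : ∀ᶠ c : ℝ in atTop, 0 < y v + c * a := by
    filter_upwards [eventually_gt_atTop (-y v / a)] with c hc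
    rw [div_lt_iff₀ ha] at hc
    linarith
  have hsupp : ∀ c : ℝ, 0 < y v + c * a →
      insert v (support (forgetCoord v y)) = support (y + c • Pi.single v a) := by
    intro c hc
    ext u
    by_cases hu : u = v
    · subst hu
      simp only [mem_insert_iff, true_or, mem_support, true_iff]
      simpa using hc.ne'
    · simp [hu, forgetCoord_apply_of_ne hu]
  rw [mem_cone_linkFaces]
  constructor
  · rintro ⟨h0, -, hD⟩
    filter_upwards [hlarge] with c hc
    refine ⟨fun u => ?_, hsupp c hc ▸ hD⟩
    by_cases hu : u = v
    · subst hu; simpa using hc.le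
    · simpa [hu, forgetCoord_apply_of_ne hu] using h0 u
  · intro h
    obtain ⟨c, hc, hmem⟩ := (hlarge.and h).exists
    refine ⟨fun u => ?_, forgetCoord_apply_same v y, hsupp c hc ▸ hmem.2⟩
    by_cases hu : u = v
    · subst hu; rw [forgetCoord_apply_same]; rfl
    · rw [forgetCoord_apply_of_ne hu]
      simpa [hu] using hmem.1 u

/-- A vertex of a complex is a vertex of each of its subdivisions. -/
theorem exists_single_of_bijOn [Finite V] [DecidableEq V] [DecidableEq W] {D : LowerSet (Set V)}
    {D' : LowerSet (Set W)} {f : (V → ℝ) →ₗ[ℝ] (W → ℝ)} (hf : BijOn f (cone D) (cone D')) {v : W}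
    (hv : {v} ∈ D') : ∃ w, {w} ∈ D ∧ ∃ a : ℝ, 0 < a ∧ f (Pi.single w 1) = Pi.single v a := by
  cases nonempty_fintype V
  obtain ⟨t, ht, e⟩ := hf.surjOn (single_mem_cone hv zero_le_one)
  have hE : ∅ ∈ D := D.lower (empty_subset _) ht.2
  have ht0 : t ≠ 0 := by
    rintro rfl
    have := congrFun e v
    simp at this
  obtain ⟨w, hw⟩ := Function.ne_iff.mp ht0
  have hwD : {w} ∈ D := singleton_mem_of_mem ht.2 hw
  have hnn : ∀ j u, 0 ≤ t j * f (Pi.single j 1) u := by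
    intro j u
    by_cases hj : t j = 0
    · simp [hj]
    · exact mul_nonneg (ht.1 j)
        ((hf.mapsTo (single_mem_cone (singleton_mem_of_mem ht.2 hj) zero_le_one)).1 u)
  -- Vertices span extreme rays: nonnegative summands whose total vanishes off `v` vanish there
  -- individually.
  have h1 : f (Pi.single w 1) = Pi.single v (f (Pi.single w 1) v) := by
    ext u
    by_cases hu : u = v
    · subst hu; simp
    · have h2 := congrFun e u
      rw [map_eq_sum_single f] at h2
      simp only [Finset.sum_apply, Pi.smul_apply, smul_eq_mul, Pi.single_eq_of_ne hu] at h2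
      have h3 := (Finset.sum_eq_zero_iff_of_nonneg fun j _ => hnn j u).mp h2 w (Finset.mem_univ w)
      rw [Pi.single_eq_of_ne hu]
      exact (mul_eq_zero.mp h3).resolve_left hw
  have hmem := hf.mapsTo (single_mem_cone hwD zero_le_one)
  refine ⟨w, hwD, _, lt_of_le_of_ne (hmem.1 v) fun h => ?_, h1⟩
  change 0 = f (Pi.single w 1) v at h
  rw [← h, Pi.single_zero] at h1
  have h4 := congrFun (hf.injOn (single_mem_cone hwD zero_le_one)
    (show (0 : V → ℝ) ∈ cone D from ⟨le_rfl, by rw [support_zero]; exact hE⟩)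
    (by rw [h1, map_zero])) w
  simp at h4

/-- The link of a vertex of a piecewise linear sphere is a piecewise linear sphere. -/
theorem PLEquiv.linkFaces [Finite V] [FiniteDimensional ℝ F] [FiniteDimensional ℝ G]
    {D : LowerSet (Set V)} (h : PLEquiv (cone D) (univ : Set F)) {v : V} (hv : {v} ∈ D)
    (hFG : Module.finrank ℝ F = Module.finrank ℝ G + 1) :
    PLEquiv (cone (CellPM.linkFaces D v)) (univ : Set G) := by
  classical
  obtain ⟨m, D', f, g, hf, hg⟩ := h
  obtain ⟨w, hw, a, ha, hwa⟩ := exists_single_of_bijOn hf hv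
  have hE : ∅ ∈ D' := D'.lower (empty_subset _) hw
  have h1 : BijOn (forgetCoord v ∘ₗ f) (cone (CellPM.linkFaces D' w))
      (cone (CellPM.linkFaces D v)) := by
    refine bijOn_linkFaces hf hw ?_ (fun y => ?_) fun t ht => ⟨t, ?_⟩
    · have : (Pi.single v a : V → ℝ) = a • Pi.single v 1 := by rw [← Pi.single_smul]; simp
      rw [ker_forgetCoord, hwa, this, Submodule.span_singleton_smul_eq (IsUnit.mk0 a ha.ne')]
    · rw [hwa]; exact forgetCoord_mem_cone_linkFaces ha y
    · ext u
      by_cases hu : u = v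
      · subst hu; rw [forgetCoord_apply_same]; exact (mem_cone_linkFaces.mp ht).2.1.symm
      · exact forgetCoord_apply_of_ne hu t
  set q := g (Pi.single w 1) with hq
  have hq0 : q ≠ 0 := by
    intro h
    have := congrFun (hg.injOn (single_mem_cone hw zero_le_one)
      (show (0 : Fin m → ℝ) ∈ cone D' from ⟨le_rfl, by rw [support_zero]; exact hE⟩)
      (by rw [map_zero]; exact h)) w
    simp at this
  -- In the vector space every direction is admissible, so the same link of `w` parametrizes the
  -- whole quotient by the line of `q`.
  have h2 : BijOn ((Submodule.mkQ (ℝ ∙ q)) ∘ₗ g) (cone (CellPM.linkFaces D' w)) univ :=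
    bijOn_linkFaces hg hw (by rw [Submodule.ker_mkQ]) (fun y => by simp)
      (fun r _ => Submodule.mkQ_surjective _ r)
  refine (PLEquiv.of_bijOn h1 h2).univ_congr ?_
  have := Submodule.finrank_quotient_add_finrank (ℝ ∙ q)
  rw [finrank_span_singleton hq0] at this
  omega

/-- If a join is a piecewise linear sphere, then so is its first factor. -/
theorem PLEquiv.of_join [Finite V] [Finite W] {D : LowerSet (Set V)} {A : Set W} (n : ℕ)
    (k : ℕ) (hk : A.ncard = k) : ∀ {D' : LowerSet (Set W)}, A ∈ D' →
    (∀ B ∈ D', A ⊆ B → B = A) →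
    PLEquiv (cone (joinFaces D D')) (univ : Set (Fin (n + k) → ℝ)) →
    PLEquiv (cone D) (univ : Set (Fin n → ℝ)) := by
  classical
  -- Passing to the link of a vertex `w` of `A` lowers the dimension by one, leaves `D` alone and
  -- replaces `A` by `A \ {w}`. When `A` is exhausted, maximality leaves only the empty face in
  -- `D'`.
  induction k generalizing A with
  | zero =>
    intro D' hA hmax h
    rw [ncard_eq_zero] at hk
    subst hk
    have hD' : ∀ s, s ∈ D' → s = ∅ := fun s hs => hmax s hs (empty_subset s)
    have hb : BijOn (LinearMap.funLeft ℝ ℝ (Sum.inl : V → V ⊕ W)) (cone (joinFaces D D'))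
        (cone D) := by
      refine ⟨fun t ht => ⟨fun v => ht.1 _, ht.2.1⟩, fun t ht t' ht' e => ?_, fun t ht => ?_⟩
      · ext (v | w)
        · exact congrFun e v
        · have h0 : ∀ s ∈ cone (joinFaces D D'), s (Sum.inr w) = 0 := by
            intro s hs
            by_contra hne
            have : w ∈ (∅ : Set W) := hD' _ hs.2.2 ▸ hne
            exact this
          rw [h0 t ht, h0 t' ht']
      · refine ⟨Sum.elim t 0, ⟨?_, ht.2, ?_⟩, rfl⟩
        · rintro (v | w)
          exacts [ht.1 v, le_rfl]
        · convert hA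
          ext w; simp
    exact (PLEquiv.of_cone hb).symm.trans h
  | succ k ih =>
    intro D' hA hmax h
    obtain ⟨w, hw⟩ : A.Nonempty := by
      rw [← ncard_pos]; omega
    have hl : PLEquiv (cone (CellPM.linkFaces (joinFaces D D') (Sum.inr w)))
        (univ : Set (Fin (n + k) → ℝ)) := by
      -- If `D` has no face at all, neither has the join, whose cone is then empty and cannot be
      -- equivalent to a vector space.
      by_cases hne : ∅ ∈ D
      · refine h.linkFaces (G := Fin (n + k) → ℝ) ⟨?_, ?_⟩ ?_
        · convert hne
          ext; simp
        · refine D'.lower ?_ hA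
          intro x hx
          have : x = w := by simpa using hx
          exact this ▸ hw
        · simp [add_assoc]
      · exfalso
        obtain ⟨m, D'', f, g, hf, hg⟩ := h
        obtain ⟨t, ht, -⟩ := hg.surjOn (mem_univ 0)
        exact hne (D.lower (empty_subset _) (hf.mapsTo ht).2.1)
    have hlink : CellPM.linkFaces (joinFaces D D') (Sum.inr w) =
        joinFaces D (CellPM.linkFaces D' w) := by
      ext s
      change (_ ∉ s ∧ Sum.inl ⁻¹' (insert (Sum.inr w) s) ∈ D ∧
        Sum.inr ⁻¹' (insert (Sum.inr w) s) ∈ D') ↔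
        (Sum.inl ⁻¹' s ∈ D ∧ w ∉ Sum.inr ⁻¹' s ∧ insert w (Sum.inr ⁻¹' s) ∈ D')
      have e1 : (Sum.inl ⁻¹' (insert (Sum.inr w) s) : Set V) = Sum.inl ⁻¹' s := by ext; simp
      have e2 : (Sum.inr ⁻¹' (insert (Sum.inr w) s) : Set W) = insert w (Sum.inr ⁻¹' s) := by
        ext; simp
      rw [e1, e2, mem_preimage]
      tauto
    rw [hlink] at hl
    have hAw : A \ {w} ∈ CellPM.linkFaces D' w :=
      ⟨by simp, by rwa [insert_sdiff_singleton, insert_eq_of_mem hw]⟩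
    refine ih (A := A \ {w}) (by rw [ncard_sdiff_singleton_of_mem hw, hk]; rfl) hAw ?_ hl
    · rintro B ⟨hwB, hB⟩ hAB
      have h1 := hmax _ hB fun x hx => by
        by_cases hxw : x = w
        · exact .inl hxw
        · exact .inr (hAB ⟨hx, hxw⟩)
      rw [← h1, insert_sdiff_of_mem _ (mem_singleton w), sdiff_singleton_eq_self hwB]

end Links

/-! ### Order complexes of products: matrices supported on chains -/

section Chains

/-- The chains of a partially ordered set. -/
def chainFaces (P : Type*) [Preorder P] : LowerSet (Set P) where
  carrier := {s | IsChain (· ≤ ·) s}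
  lower' := fun _ _ hts hs => hs.mono hts

theorem mem_chainFaces {P : Type*} [Preorder P] {s : Set P} :
    s ∈ chainFaces P ↔ IsChain (· ≤ ·) s := Iff.rfl

/-- The proper elements of a bounded poset. -/
abbrev Proper (M : Type*) [LE M] [BoundedOrder M] : Type _ := {x : M // x ≠ ⊥ ∧ x ≠ ⊤}

theorem faceSets_barycentric {M : Type*} [Lattice M] [BoundedOrder M] [Finite M] :
    faceSets (barycentric M) = chainFaces (Proper M) := by
  ext s
  constructor
  · rintro (rfl | ⟨A, hA, rfl⟩)
    exacts [IsChain.empty, hA.2]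
  · intro hs
    rcases s.eq_empty_or_nonempty with h | h
    · exact .inl h
    · exact .inr ⟨(toFinite s).toFinset, ⟨by simpa using h, by simpa using mem_chainFaces.mp hs⟩, by simp⟩

theorem support_sub_single_subset {P : Type*} [DecidableEq P] {T : P → ℝ} {x : P} (hx : T x ≠ 0) (δ : ℝ) :
    support (T - Pi.single x δ) ⊆ support T := by
  intro y hy
  by_cases h : y = x
  · exact h ▸ hx
  · simpa [h] using hy

theorem sub_single_mem_cone {P : Type*} [DecidableEq P] {D : LowerSet (Set P)} {T : P → ℝ} (hT : T ∈ cone D)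
    {x : P} (hx : 0 < T x) {δ : ℝ} (hδ : δ ≤ T x) : T - Pi.single x δ ∈ cone D := by
  refine ⟨fun y => ?_, D.lower (support_sub_single_subset hx.ne' δ) hT.2⟩
  by_cases h : y = x
  · subst h; simpa using hδ
  · simpa [h] using hT.1 y

theorem ncard_support_sub_single {P : Type*} [Finite P] [DecidableEq P] {T : P → ℝ} {x : P} (hx : 0 < T x) :
    (support (T - Pi.single x (T x))).ncard < (support T).ncard := by
  refine ncard_lt_ncard ?_ (toFinite _)
  refine (support_sub_single_subset hx.ne' _).ssubset_of_ne fun h => ?_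
  have : x ∈ support (T - Pi.single x (T x)) := h ▸ hx.ne'
  simp at this

/-- Row sums of a matrix. -/
def rowSum {P Q : Type*} [Fintype Q] : (P × Q → ℝ) →ₗ[ℝ] (P → ℝ) :=
  LinearMap.pi fun x => ∑ y, LinearMap.proj (R := ℝ) (φ := fun _ : P × Q => ℝ) (x, y)

/-- Column sums of a matrix. -/
def colSum {P Q : Type*} [Fintype P] : (P × Q → ℝ) →ₗ[ℝ] (Q → ℝ) :=
  LinearMap.pi fun y => ∑ x, LinearMap.proj (R := ℝ) (φ := fun _ : P × Q => ℝ) (x, y)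

theorem rowSum_apply {P Q : Type*} [Fintype Q] (w : P × Q → ℝ) (x : P) : rowSum w x = ∑ y, w (x, y) := by
  simp [rowSum]

theorem colSum_apply {P Q : Type*} [Fintype P] (w : P × Q → ℝ) (y : Q) : colSum w y = ∑ x, w (x, y) := by
  simp [colSum]

theorem sum_rowSum {P Q : Type*} [Fintype P] [Fintype Q] (w : P × Q → ℝ) : ∑ x, rowSum w x = ∑ y, colSum w y := by
  simp only [rowSum_apply, colSum_apply]
  exact Finset.sum_comm

/-- Extension by zero from the proper elements. -/
noncomputable def extendProper (P : Type*) [LE P] [BoundedOrder P] :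
    (Proper P → ℝ) →ₗ[ℝ] (P → ℝ) :=
  Function.ExtendByZero.linearMap ℝ (Subtype.val : Proper P → P)

section Extension

variable {P : Type*} [PartialOrder P] [BoundedOrder P]

@[simp]
theorem extendProper_apply (t : Proper P → ℝ) (x : Proper P) : extendProper P t x.1 = t x :=
  Subtype.val_injective.extend_apply t 0 x

theorem extendProper_of_not (t : Proper P → ℝ) {x : P} (hx : ¬ (x ≠ ⊥ ∧ x ≠ ⊤)) :
    extendProper P t x = 0 :=
  extend_apply' t (0 : P → ℝ) x fun ⟨a, ha⟩ => hx (ha ▸ a.2)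

@[simp]
theorem extendProper_bot (t : Proper P → ℝ) : extendProper P t (⊥ : P) = 0 :=
  extendProper_of_not t (by simp)

@[simp]
theorem extendProper_top (t : Proper P → ℝ) : extendProper P t (⊤ : P) = 0 :=
  extendProper_of_not t (by simp)

theorem extendProper_mem_cone {t : Proper P → ℝ} (ht : t ∈ cone (chainFaces (Proper P))) :
    extendProper P t ∈ cone (chainFaces P) := by
  refine ⟨fun x => ?_, (chainFaces P).lower (a := Subtype.val '' support t) ?_ ?_⟩
  · by_cases hx : x ≠ ⊥ ∧ x ≠ ⊤
    · exact (extendProper_apply t ⟨x, hx⟩).symm ▸ ht.1 _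
    · rw [extendProper_of_not t hx]; rfl
  · intro x hx
    have hx' : x ≠ ⊥ ∧ x ≠ ⊤ := by
      by_contra h; exact hx (extendProper_of_not t h)
    exact ⟨⟨x, hx'⟩, by rwa [mem_support, ← extendProper_apply t], rfl⟩
  · exact (Subtype.mono_coe _).isChain_image ht.2

theorem comp_val_mem_cone {t : P → ℝ} (ht : t ∈ cone (chainFaces P)) :
    (fun x : Proper P => t x) ∈ cone (chainFaces (Proper P)) := by
  refine ⟨fun x => ht.1 x, fun x hx y hy hxy => ?_⟩
  exact ht.2 hx hy (Subtype.coe_ne_coe.mpr hxy)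

theorem exists_extension [Nontrivial P] {t : Proper P → ℝ} (ht : t ∈ cone (chainFaces (Proper P)))
    {a b : ℝ} (ha : 0 ≤ a) (hb : 0 ≤ b) :
    ∃ U ∈ cone (chainFaces P), U ⊥ = a ∧ U ⊤ = b ∧ ∀ x : Proper P, U x = t x := by
  classical
  have he := extendProper_mem_cone ht
  refine ⟨extendProper P t + Pi.single ⊥ a + Pi.single ⊤ b, ⟨?_, ?_⟩, by simp, by simp, fun x => ?_⟩
  · exact add_nonneg (add_nonneg he.1 (Pi.single_nonneg.mpr ha)) (Pi.single_nonneg.mpr hb)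
  · refine (chainFaces P).lower (a := insert ⊤ (insert ⊥ (support (extendProper P t)))) ?_ ?_
    · intro x hx
      by_cases h1 : x = ⊤
      · exact .inl h1
      by_cases h2 : x = ⊥
      · exact .inr (.inl h2)
      · exact .inr (.inr (by simpa [h1, h2] using hx))
    · exact (IsChain.insert he.2 fun x _ _ => .inl bot_le).insert fun x _ _ => .inr le_top
  · simp [x.2.1, x.2.2]

end Extension

variable {P Q : Type*} [PartialOrder P] [PartialOrder Q] [Fintype P] [Fintype Q]

/-- A nonnegative matrix supported on a chain is determined by its row and column sums. -/
theorem eq_of_sums_eq {w w' : P × Q → ℝ} (hw : w ∈ cone (chainFaces (P × Q)))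
    (hw' : w' ∈ cone (chainFaces (P × Q))) (h1 : ∀ x, ∑ y, w (x, y) = ∑ y, w' (x, y))
    (h2 : ∀ y, ∑ x, w (x, y) = ∑ x, w' (x, y)) : w = w' := by
  classical
  -- on a chain, the lower sets `{z | z.1 ≤ x}` and `{z | z.2 ≤ y}` are nested
  have key : ∀ u ∈ cone (chainFaces (P × Q)), ∀ z : P × Q,
      ∑ a with a ≤ z, u a = min (∑ a with a.1 ≤ z.1, u a) (∑ a with a.2 ≤ z.2, u a) := by
    intro u hu z
    have hle1 : ∑ a with a ≤ z, u a ≤ ∑ a with a.1 ≤ z.1, u a :=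
      Finset.sum_le_sum_of_subset_of_nonneg (fun a ha => by simp at ha ⊢; exact ha.1)
        fun a _ _ => hu.1 a
    have hle2 : ∑ a with a ≤ z, u a ≤ ∑ a with a.2 ≤ z.2, u a :=
      Finset.sum_le_sum_of_subset_of_nonneg (fun a ha => by simp at ha ⊢; exact ha.2)
        fun a _ _ => hu.1 a
    have hnest : (∀ a, u a ≠ 0 → a.1 ≤ z.1 → a.2 ≤ z.2) ∨
        (∀ a, u a ≠ 0 → a.2 ≤ z.2 → a.1 ≤ z.1) := by
      by_contra! h
      obtain ⟨⟨a, ha, ha1, ha2⟩, b, hb, hb2, hb1⟩ := h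
      rcases hu.2.total ha hb with hab | hab
      · exact ha2 (hab.2.trans hb2)
      · exact hb1 (hab.1.trans ha1)
    rcases hnest with h | h
    · rw [min_eq_left]
      · refine le_antisymm hle1 (le_of_eq ?_)
        refine (Finset.sum_subset (fun a ha => by simp at ha ⊢; exact ha.1) fun a ha ha' => ?_).symm
        by_contra h0
        simp only [Finset.mem_filter, Finset.mem_univ, true_and] at ha ha'
        exact ha' ⟨ha, h a h0 ha⟩
      · refine le_trans (le_of_eq ?_) hle2
        refine (Finset.sum_subset (fun a ha => by simp at ha ⊢; exact ha.1) fun a ha ha' => ?_).symm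
        by_contra h0
        simp only [Finset.mem_filter, Finset.mem_univ, true_and] at ha ha'
        exact ha' ⟨ha, h a h0 ha⟩
    · rw [min_eq_right]
      · refine le_antisymm hle2 (le_of_eq ?_)
        refine (Finset.sum_subset (fun a ha => by simp at ha ⊢; exact ha.2) fun a ha ha' => ?_).symm
        by_contra h0
        simp only [Finset.mem_filter, Finset.mem_univ, true_and] at ha ha'
        exact ha' ⟨h a h0 ha, ha⟩
      · refine le_trans (le_of_eq ?_) hle1
        refine (Finset.sum_subset (fun a ha => by simp at ha ⊢; exact ha.2) fun a ha ha' => ?_).symm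
        by_contra h0
        simp only [Finset.mem_filter, Finset.mem_univ, true_and] at ha ha'
        exact ha' ⟨h a h0 ha, ha⟩
  have r1 : ∀ x, ∑ a with a.1 ≤ x, w a = ∑ a with a.1 ≤ x, w' a := by
    intro x
    simp only [Finset.sum_filter, Fintype.sum_prod_type]
    refine Finset.sum_congr rfl fun b _ => ?_
    by_cases hb : b ≤ x <;> simp [hb, h1]
  have r2 : ∀ y, ∑ a with a.2 ≤ y, w a = ∑ a with a.2 ≤ y, w' a := by
    intro y
    simp only [Finset.sum_filter, Fintype.sum_prod_type_right]
    refine Finset.sum_congr rfl fun b _ => ?_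
    by_cases hb : b ≤ y <;> simp [hb, h2]
  -- The sums over principal lower sets are thus functions of the marginals; single entries are
  -- recovered from them by induction from below.
  have r3 : ∀ z, ∑ a with a ≤ z, w a = ∑ a with a ≤ z, w' a := fun z => by
    rw [key w hw, key w' hw', r1, r2]
  ext z
  induction z using WellFoundedLT.induction with
  | _ z ih =>
    have e : ∀ u : P × Q → ℝ, ∑ a with a ≤ z, u a = (∑ a with a < z, u a) + u z := by
      intro u
      rw [add_comm, ← Finset.sum_insert (by simp)]
      refine Finset.sum_congr ?_ fun _ _ => rfl
      ext a
      simp [le_iff_lt_or_eq, or_comm]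
    have h3 := r3 z
    rw [e w, e w', Finset.sum_congr rfl fun a ha => ih a (by simpa using ha)] at h3
    exact add_left_cancel h3

theorem exists_max_support {T : P → ℝ} (hT : T ∈ cone (chainFaces P)) (hT0 : T ≠ 0) :
    ∃ x, 0 < T x ∧ ∀ y ∈ support T, y ≤ x := by
  obtain ⟨x, hx⟩ := (toFinite (support T)).exists_maximal (support_nonempty_iff.mpr hT0)
  refine ⟨x, lt_of_le_of_ne (hT.1 x) (Ne.symm hx.1), fun y hy => ?_⟩
  rcases hT.2.total hy hx.1 with h | h
  · exact h
  · exact hx.2 hy h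

/-- Two nonnegative vectors supported on chains and with equal sums are the vectors of row and
column sums of a nonnegative matrix supported on a chain. -/
theorem exists_matrix_of_sums (n : ℕ) : ∀ {U : P → ℝ} {V : Q → ℝ}, U ∈ cone (chainFaces P) →
    V ∈ cone (chainFaces Q) → ∑ x, U x = ∑ y, V y → (support U).ncard + (support V).ncard = n →
    ∃ w ∈ cone (chainFaces (P × Q)), (∀ x, ∑ y, w (x, y) = U x) ∧ ∀ y, ∑ x, w (x, y) = V y := by
  classical
  induction n using Nat.strong_induction_on with
  | _ n ih =>
  intro U V hU hV hUV hn
  by_cases hU0 : U = 0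
  · have hV0 : V = 0 := by
      by_contra h
      have := sum_pos_of_mem_cone hV h
      rw [← hUV, hU0] at this
      simp at this
    exact ⟨0, ⟨le_rfl, by rw [support_zero]; exact IsChain.empty⟩, by simp [hU0], by simp [hV0]⟩
  have hV0 : V ≠ 0 := by
    rintro rfl
    have := sum_pos_of_mem_cone hU hU0
    rw [hUV] at this
    simp at this
  obtain ⟨x, hx, hxmax⟩ := exists_max_support hU hU0
  obtain ⟨y, hy, hymax⟩ := exists_max_support hV hV0
  -- North-west corner rule, started at the top: the two largest elements are paired with the
  -- greatest possible weight, which removes at least one of them from its support. All remaining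
  -- pairs lie below `(x, y)`, so the support stays a chain.
  set δ := min (U x) (V y) with hδ
  have hδ0 : 0 < δ := lt_min hx hy
  have hlt : (support (U - Pi.single x δ)).ncard + (support (V - Pi.single y δ)).ncard < n := by
    have h1 := ncard_le_ncard (support_sub_single_subset hx.ne' δ) (toFinite _)
    have h2 := ncard_le_ncard (support_sub_single_subset hy.ne' δ) (toFinite _)
    rcases min_choice (U x) (V y) with h | h <;> rw [← hδ] at h
    · have := ncard_support_sub_single hx
      rw [← h] at this
      omega
    · have := ncard_support_sub_single hy
      rw [← h] at this
      omega
  obtain ⟨w, hw, hwU, hwV⟩ := ih _ hlt (sub_single_mem_cone hU hx (min_le_left _ _))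
    (sub_single_mem_cone hV hy (min_le_right _ _)) (by simp [Finset.sum_sub_distrib, hUV]) rfl
  have hbound : ∀ z ∈ support w, z ≤ (x, y) := by
    rintro ⟨a, b⟩ hab
    have hpos : 0 < w (a, b) := lt_of_le_of_ne (hw.1 _) (Ne.symm hab)
    refine ⟨hxmax a (support_sub_single_subset hx.ne' δ ?_),
      hymax b (support_sub_single_subset hy.ne' δ ?_)⟩
    · rw [mem_support, ← hwU]
      exact (hpos.trans_le (Finset.single_le_sum (f := fun b => w (a, b)) (fun b _ => hw.1 (a, b))
        (Finset.mem_univ b))).ne'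
    · rw [mem_support, ← hwV]
      exact (hpos.trans_le (Finset.single_le_sum (f := fun a => w (a, b)) (fun a _ => hw.1 (a, b))
        (Finset.mem_univ a))).ne'
  refine ⟨w + Pi.single (x, y) δ, ⟨add_nonneg hw.1 (Pi.single_nonneg.mpr hδ0.le), ?_⟩,
    fun a => ?_, fun b => ?_⟩
  · refine (chainFaces (P × Q)).lower (a := insert (x, y) (support w)) ?_ ?_
    · intro z hz
      by_cases h : z = (x, y)
      · exact .inl h
      · exact .inr (by simpa [h] using hz)
    · exact hw.2.insert fun z hz _ => .inr (hbound z hz)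
  · have h1 : ∑ b, (w + Pi.single (x, y) δ : P × Q → ℝ) (a, b) = (U - Pi.single x δ : P → ℝ) a +
        ∑ b, (Pi.single (x, y) δ : P × Q → ℝ) (a, b) := by
      rw [← hwU, ← Finset.sum_add_distrib]; rfl
    have h2 : ∑ b, (Pi.single (x, y) δ : P × Q → ℝ) (a, b) = (Pi.single x δ : P → ℝ) a := by
      by_cases h : a = x <;> simp [Pi.single_apply, h]
    rw [h1, h2]; simp
  · have h1 : ∑ a, (w + Pi.single (x, y) δ : P × Q → ℝ) (a, b) = (V - Pi.single y δ : Q → ℝ) b +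
        ∑ a, (Pi.single (x, y) δ : P × Q → ℝ) (a, b) := by
      rw [← hwV, ← Finset.sum_add_distrib]; rfl
    have h2 : ∑ a, (Pi.single (x, y) δ : P × Q → ℝ) (a, b) = (Pi.single y δ : Q → ℝ) b := by
      by_cases h : b = y <;> simp [Pi.single_apply, h]
    rw [h1, h2]; simp

theorem rowSum_mem_cone {P Q : Type*} [PartialOrder P] [PartialOrder Q] [Fintype Q] {w : P × Q → ℝ} (hw : w ∈ cone (chainFaces (P × Q))) :
    rowSum w ∈ cone (chainFaces P) := by
  refine ⟨fun x => ?_, (chainFaces P).lower (a := Prod.fst '' support w) ?_ ?_⟩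
  · rw [rowSum_apply]; exact Finset.sum_nonneg fun y _ => hw.1 _
  · intro x hx
    rw [mem_support, rowSum_apply] at hx
    obtain ⟨y, -, hy⟩ := Finset.exists_ne_zero_of_sum_ne_zero hx
    exact ⟨(x, y), hy, rfl⟩
  · exact monotone_fst.isChain_image hw.2

theorem colSum_mem_cone {P Q : Type*} [PartialOrder P] [PartialOrder Q] [Fintype P] {w : P × Q → ℝ} (hw : w ∈ cone (chainFaces (P × Q))) :
    colSum w ∈ cone (chainFaces Q) := by
  refine ⟨fun x => ?_, (chainFaces Q).lower (a := Prod.snd '' support w) ?_ ?_⟩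
  · rw [colSum_apply]; exact Finset.sum_nonneg fun y _ => hw.1 _
  · intro x hx
    rw [mem_support, colSum_apply] at hx
    obtain ⟨y, -, hy⟩ := Finset.exists_ne_zero_of_sum_ne_zero hx
    exact ⟨(y, x), hy, rfl⟩
  · exact monotone_snd.isChain_image hw.2

/-- If both sums were nonzero, the chain would contain some `(⊥, y)` and some `(x, ⊥)`. They are
comparable, and the smaller of them is `⊥`. -/
theorem bot_rowSum_or_colSum [OrderBot P] [OrderBot Q] {w : P × Q → ℝ}
    (hw : w ∈ cone (chainFaces (P × Q))) (h : w ⊥ = 0) : rowSum w ⊥ = 0 ∨ colSum w ⊥ = 0 := by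
  by_contra! hne
  rw [rowSum_apply, colSum_apply] at hne
  obtain ⟨y, -, hy⟩ := Finset.exists_ne_zero_of_sum_ne_zero hne.1
  obtain ⟨x, -, hx⟩ := Finset.exists_ne_zero_of_sum_ne_zero hne.2
  rcases hw.2.total hy hx with h1 | h1
  · have : y = ⊥ := le_bot_iff.mp h1.2
    subst this; exact hy h
  · have : x = ⊥ := le_bot_iff.mp h1.1
    subst this; exact hx h

theorem top_rowSum_or_colSum [OrderTop P] [OrderTop Q] {w : P × Q → ℝ}
    (hw : w ∈ cone (chainFaces (P × Q))) (h : w ⊤ = 0) : rowSum w ⊤ = 0 ∨ colSum w ⊤ = 0 := by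
  by_contra! hne
  rw [rowSum_apply, colSum_apply] at hne
  obtain ⟨y, -, hy⟩ := Finset.exists_ne_zero_of_sum_ne_zero hne.1
  obtain ⟨x, -, hx⟩ := Finset.exists_ne_zero_of_sum_ne_zero hne.2
  rcases hw.2.total hy hx with h1 | h1
  · have : x = ⊤ := top_le_iff.mp h1.1
    subst this; exact hx h
  · have : y = ⊤ := top_le_iff.mp h1.2
    subst this; exact hy h

/-! ### The order complex of a product as a subdivided join with `S⁰` -/

section Bounded

variable [BoundedOrder P] [BoundedOrder Q]

theorem sum_eq_proper [Nontrivial P] [Fintype (Proper P)] (t : P → ℝ) :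
    ∑ x, t x = t ⊥ + t ⊤ + ∑ x : Proper P, t x := by
  classical
  have h1 : ∑ x : Proper P, t x = ∑ x with x ≠ ⊥ ∧ x ≠ ⊤, t x :=
    (Finset.sum_subtype _ (by simp) t).symm
  have h2 : (Finset.univ.filter fun x : P => ¬ (x ≠ ⊥ ∧ x ≠ ⊤)) = {⊥, ⊤} := by
    ext x; simp; tauto
  rw [h1, ← Finset.sum_filter_add_sum_filter_not _ (fun x : P => x ≠ ⊥ ∧ x ≠ ⊤) t, h2,
    Finset.sum_pair bot_ne_top, add_comm]

variable (P Q) in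
/-- The map exhibiting the order complex of the proper part of a product as a subdivision of the
join of the order complexes of the proper parts of the factors and of a `0`-sphere. -/
noncomputable def mergeMap :
    (Proper (P × Q) → ℝ) →ₗ[ℝ] (Proper P → ℝ) × (Proper Q → ℝ) × ℝ :=
  ((LinearMap.funLeft ℝ ℝ Subtype.val ∘ₗ rowSum).prod
    ((LinearMap.funLeft ℝ ℝ Subtype.val ∘ₗ colSum).prod
      (LinearMap.proj ⊥ ∘ₗ rowSum - LinearMap.proj ⊥ ∘ₗ colSum))) ∘ₗ extendProper (P × Q)

theorem mergeMap_apply (w : Proper (P × Q) → ℝ) : mergeMap P Q w =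
    (fun x : Proper P => rowSum (extendProper (P × Q) w) x,
      fun y : Proper Q => colSum (extendProper (P × Q) w) y,
      rowSum (extendProper (P × Q) w) ⊥ - colSum (extendProper (P × Q) w) ⊥) := rfl

/-- Since `⊥` carries no weight, one of the two marginals at `⊥` vanishes, so their difference
recovers both as positive and negative part. The same holds at `⊤`, where the difference is fixed by
the equality of the total row and column sums. All marginals are then known, and chain-supported
matrices correspond to their marginals. -/
theorem bijOn_mergeMap [Nontrivial P] [Nontrivial Q] :
    BijOn (mergeMap P Q) (cone (chainFaces (Proper (P × Q))))
      (cone (chainFaces (Proper P)) ×ˢ cone (chainFaces (Proper Q)) ×ˢ univ) := by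
  classical
  have split : ∀ {a b a' b' : ℝ}, 0 ≤ a → 0 ≤ b → 0 ≤ a' → 0 ≤ b' → (a = 0 ∨ b = 0) →
      (a' = 0 ∨ b' = 0) → a - b = a' - b' → a = a' ∧ b = b' := by
    rintro a b a' b' h1 h2 h3 h4 (h5 | h5) (h6 | h6) h <;> subst h5 <;> subst h6 <;>
      constructor <;> linarith
  refine ⟨fun w hw => ?_, fun w hw w' hw' e => ?_, ?_⟩
  · have hW := extendProper_mem_cone hw
    exact ⟨comp_val_mem_cone (rowSum_mem_cone hW), comp_val_mem_cone (colSum_mem_cone hW), trivial⟩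
  · have hW := extendProper_mem_cone hw
    have hW' := extendProper_mem_cone hw'
    rw [mergeMap_apply, mergeMap_apply] at e
    set W := extendProper (P × Q) w with hWdef
    set W' := extendProper (P × Q) w' with hWdef'
    simp only [Prod.mk.injEq] at e
    obtain ⟨e1, e2, e3⟩ := e
    have r := rowSum_mem_cone hW
    have r' := rowSum_mem_cone hW'
    have c := colSum_mem_cone hW
    have c' := colSum_mem_cone hW'
    have hbot := split (r.1 ⊥) (c.1 ⊥) (r'.1 ⊥) (c'.1 ⊥)
      (bot_rowSum_or_colSum hW (extendProper_bot w))
      (bot_rowSum_or_colSum hW' (extendProper_bot w')) e3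
    have hsum := sum_rowSum W
    have hsum' := sum_rowSum W'
    rw [sum_eq_proper (rowSum W), sum_eq_proper (colSum W)] at hsum
    rw [sum_eq_proper (rowSum W'), sum_eq_proper (colSum W'),
      ← Finset.sum_congr rfl fun x _ => congrFun e1 x,
      ← Finset.sum_congr rfl fun x _ => congrFun e2 x] at hsum'
    have htop := split (r.1 ⊤) (c.1 ⊤) (r'.1 ⊤) (c'.1 ⊤)
      (top_rowSum_or_colSum hW (extendProper_top w))
      (top_rowSum_or_colSum hW' (extendProper_top w'))
      (by rw [hbot.1, hbot.2] at hsum; linarith)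
    have hWW : W = W' := by
      refine eq_of_sums_eq hW hW' (fun x => ?_) (fun y => ?_)
      · rw [← rowSum_apply, ← rowSum_apply]
        by_cases hx : x ≠ ⊥ ∧ x ≠ ⊤
        · exact congrFun e1 ⟨x, hx⟩
        · rw [not_and_or, not_not, not_not] at hx
          rcases hx with rfl | rfl
          exacts [hbot.1, htop.1]
      · rw [← colSum_apply, ← colSum_apply]
        by_cases hy : y ≠ ⊥ ∧ y ≠ ⊤
        · exact congrFun e2 ⟨y, hy⟩
        · rw [not_and_or, not_not, not_not] at hy
          rcases hy with rfl | rfl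
          exacts [hbot.2, htop.2]
    ext z
    rw [← extendProper_apply w, ← extendProper_apply w', ← hWdef, hWW]
  · rintro ⟨t, t', s⟩ ⟨ht, ht', -⟩
    -- `d` is the surplus of the column side once the weights at `⊥` are chosen; its positive and
    -- negative parts, placed at the two tops, equalize the totals.
    set d := (∑ y, t' y + max (-s) 0) - (∑ x, t x + max s 0) with hd
    obtain ⟨U, hU, hUb, hUt, hUx⟩ :=
      exists_extension ht (le_max_right s 0) (le_max_right d 0)
    obtain ⟨V, hV, hVb, hVt, hVx⟩ :=
      exists_extension ht' (le_max_right (-s) 0) (le_max_right (-d) 0)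
    have hUV : ∑ x, U x = ∑ y, V y := by
      rw [sum_eq_proper U, sum_eq_proper V, hUb, hUt, hVb, hVt,
        Finset.sum_congr rfl fun x _ => hUx x, Finset.sum_congr rfl fun x _ => hVx x]
      have : max d 0 - max (-d) 0 = d := by
        rcases le_total d 0 with h | h
        · rw [max_eq_right h, max_eq_left (by linarith)]; ring
        · rw [max_eq_left h, max_eq_right (by linarith)]; ring
      linarith
    obtain ⟨W, hW, hWU, hWV⟩ := exists_matrix_of_sums _ hU hV hUV rfl
    have hle : ∀ x y, W (x, y) ≤ U x ∧ W (x, y) ≤ V y := fun x y =>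
      ⟨hWU x ▸ Finset.single_le_sum (f := fun y => W (x, y)) (fun y _ => hW.1 (x, y))
        (Finset.mem_univ y),
      hWV y ▸ Finset.single_le_sum (f := fun x => W (x, y)) (fun x _ => hW.1 (x, y))
        (Finset.mem_univ x)⟩
    -- An entry is bounded by both of its marginals, and at `⊥` and at `⊤` one of the two is zero by
    -- construction.
    have hzero : ∀ z : P × Q, ¬ (z ≠ ⊥ ∧ z ≠ ⊤) → W z = 0 := by
      intro z hz
      have h0 := hW.1 z
      simp only [Pi.zero_apply] at h0
      rw [not_and_or, not_not, not_not] at hz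
      rcases hz with rfl | rfl
      · have h1 := hle ⊥ ⊥
        rw [hUb, hVb] at h1
        refine le_antisymm ?_ h0
        rcases le_total s 0 with h | h
        · rw [max_eq_right h] at h1; exact h1.1
        · rw [max_eq_right (neg_nonpos.mpr h)] at h1; exact h1.2
      · have h1 := hle ⊤ ⊤
        rw [hUt, hVt] at h1
        refine le_antisymm ?_ h0
        rcases le_total d 0 with h | h
        · rw [max_eq_right h] at h1; exact h1.1
        · rw [max_eq_right (neg_nonpos.mpr h)] at h1; exact h1.2
    have hext : extendProper (P × Q) (fun z : Proper (P × Q) => W z) = W := by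
      ext z
      by_cases hz : z ≠ ⊥ ∧ z ≠ ⊤
      · exact extendProper_apply (fun z : Proper (P × Q) => W z) ⟨z, hz⟩
      · rw [extendProper_of_not _ hz, hzero z hz]
    refine ⟨fun z => W z, comp_val_mem_cone hW, ?_⟩
    rw [mergeMap_apply, hext]
    have hr : ∀ x, rowSum W x = U x := fun x => (rowSum_apply W x).trans (hWU x)
    have hc : ∀ y, colSum W y = V y := fun y => (colSum_apply W y).trans (hWV y)
    refine Prod.ext (funext fun x => (hr x).trans (hUx x))
      (Prod.ext (funext fun y => (hc y).trans (hVx y)) ?_)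
    change rowSum W ⊥ - colSum W ⊥ = s
    rw [hr, hc, hUb, hVb]
    rcases le_total s 0 with h | h
    · rw [max_eq_right h, max_eq_left (by linarith)]; ring
    · rw [max_eq_left h, max_eq_right (by linarith)]; ring

end Bounded

end Chains

/-! ### Rank, thinness and connectedness of products -/

section Rank

theorem height_lt_top {M : Type*} [PartialOrder M] [Finite M] (x : M) : Order.height x < ⊤ := by
  cases nonempty_fintype M
  refine lt_of_le_of_lt (Order.height_le (n := (Fintype.card M : ℕ)) fun p _ => ?_)
    (ENat.natCast_lt_top _)
  exact_mod_cast (LTSeries.length_lt_card p).le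

theorem Ioo_mk_left {M N : Type*} [PartialOrder M] [PartialOrder N] (x : M) (a b : N) : Ioo (x, a) (x, b) = Prod.mk x '' Ioo a b := by
  ext ⟨c, d⟩
  constructor
  · rintro ⟨h1, h2⟩
    obtain rfl : c = x := le_antisymm h2.le.1 h1.le.1
    exact ⟨d, ⟨Prod.mk_lt_mk_iff_right.mp h1, Prod.mk_lt_mk_iff_right.mp h2⟩, rfl⟩
  · rintro ⟨e, ⟨h1, h2⟩, h⟩
    obtain ⟨rfl, rfl⟩ := Prod.mk.inj h
    exact ⟨Prod.mk_lt_mk_iff_right.mpr h1, Prod.mk_lt_mk_iff_right.mpr h2⟩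

theorem Ioo_mk_right {M N : Type*} [PartialOrder M] [PartialOrder N] (y : N) (a b : M) : Ioo (a, y) (b, y) = (fun x => (x, y)) '' Ioo a b := by
  ext ⟨c, d⟩
  constructor
  · rintro ⟨h1, h2⟩
    obtain rfl : d = y := le_antisymm h2.le.2 h1.le.2
    exact ⟨c, ⟨Prod.mk_lt_mk_iff_left.mp h1, Prod.mk_lt_mk_iff_left.mp h2⟩, rfl⟩
  · rintro ⟨e, ⟨h1, h2⟩, h⟩
    obtain ⟨rfl, rfl⟩ := Prod.mk.inj h
    exact ⟨Prod.mk_lt_mk_iff_left.mpr h1, Prod.mk_lt_mk_iff_left.mpr h2⟩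

variable {M N : Type*} [Lattice M] [BoundedOrder M] [Lattice N] [BoundedOrder N]

theorem coe_rank {M : Type*} [Lattice M] [Finite M] (x : M) : (rank x : ℕ∞) = Order.height x :=
  ENat.natCast_toNat (height_lt_top x).ne

theorem rank_bot : rank (⊥ : M) = 0 := by simp [rank]

theorem rank_strictMono {M : Type*} [Lattice M] [Finite M] : StrictMono (rank : M → ℕ) := by
  intro x y h
  have := Order.height_strictMono h (height_lt_top x)
  rw [← coe_rank, ← coe_rank] at this
  exact_mod_cast this

/-- Strict monotonicity of `ρ` bounds the length of every chain, and descending through covers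
produces a chain of length `ρ x`. -/
theorem rank_eq_of_covBy [Finite M] {ρ : M → ℕ} (h0 : ρ ⊥ = 0)
    (hρ : ∀ a b : M, a ⋖ b → ρ b = ρ a + 1) (x : M) : rank x = ρ x := by
  classical
  cases nonempty_fintype M
  let : LocallyFiniteOrder M := Fintype.toLocallyFiniteOrder
  have hmono : StrictMono ρ := (strictMono_iff_forall_covBy ρ).mpr fun a b h => by
    rw [hρ a b h]; exact Nat.lt_succ_self _
  refine le_antisymm ?_ ?_
  · have := Order.height_le_height_apply_of_strictMono ρ hmono x
    rw [Order.height_nat, ← coe_rank] at this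
    exact_mod_cast this
  · induction x using WellFoundedLT.induction with
    | _ x ih =>
      rcases eq_bot_or_bot_lt x with rfl | hx
      · rw [h0]; exact Nat.zero_le _
      · obtain ⟨a, -, ha⟩ := exists_le_covBy_of_lt hx
        rw [hρ a x ha]
        exact (Nat.succ_le_succ (ih a ha.lt)).trans (rank_strictMono ha.lt)

theorem isRanked_of_covBy [Finite M] (h : ∀ a b : M, a ⋖ b → rank b = rank a + 1) :
    IsRanked M := by
  intro s hs
  have key : ∀ (n : ℕ) (hn : n < s.length + 1), rank (s ⟨n, hn⟩) = n := by
    intro n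
    induction n with
    | zero => intro hn; exact (congrArg rank hs).trans rank_bot
    | succ n ih =>
      intro hn
      exact (h _ _ (s.step ⟨n, by omega⟩)).trans (congrArg (· + 1) (ih (by omega)))
  exact (key s.length (by omega)).symm

theorem IsRanked.rank_covBy [Finite M] (h : IsRanked M) {a b : M} (hab : a ⋖ b) :
    rank b = rank a + 1 := by
  have key : ∀ x : M, ∃ s : RelSeries {(a, b) : M × M | a ⋖ b}, s.head = ⊥ ∧ s.last = x := by
    intro x
    induction x using WellFoundedLT.induction with
    | _ x ih =>
      rcases eq_bot_or_bot_lt x with rfl | hx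
      · exact ⟨RelSeries.singleton _ ⊥, rfl, rfl⟩
      · obtain ⟨a, -, ha⟩ := exists_le_covBy_of_lt hx
        obtain ⟨s, hs, hsa⟩ := ih a ha.lt
        subst hsa
        exact ⟨s.snoc x ha, by simpa using hs, by simp⟩
  obtain ⟨s, hs, rfl⟩ := key a
  have h1 := h s hs
  have h2 := h (s.snoc b hab) (by simpa using hs)
  rw [RelSeries.last_snoc, RelSeries.snoc_length] at h2
  omega

theorem rank_mk [Finite M] [Finite N] (hM : IsRanked M) (hN : IsRanked N) (z : M × N) :
    rank z = rank z.1 + rank z.2 := by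
  refine rank_eq_of_covBy (ρ := fun z : M × N => rank z.1 + rank z.2) ?_ ?_ z
  · exact congrArg₂ (· + ·) (rank_bot (M := M)) (rank_bot (M := N))
  · rintro ⟨a, b⟩ ⟨a', b'⟩ h
    rcases Prod.mk_covBy_mk_iff.mp h with ⟨h1, rfl⟩ | ⟨h1, rfl⟩
    · simp only [hM.rank_covBy h1]; omega
    · simp only [hN.rank_covBy h1]; omega

theorem isRanked_prod [Finite M] [Finite N] (hM : IsRanked M) (hN : IsRanked N) :
    IsRanked (M × N) := by
  refine isRanked_of_covBy ?_
  rintro ⟨a, b⟩ ⟨a', b'⟩ h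
  rw [rank_mk hM hN, rank_mk hM hN]
  rcases Prod.mk_covBy_mk_iff.mp h with ⟨h1, rfl⟩ | ⟨h1, rfl⟩
  · simp only [hM.rank_covBy h1]; omega
  · simp only [hN.rank_covBy h1]; omega

theorem eq_of_le_of_rank_le {M : Type*} [Lattice M] [Finite M] {x y : M} (h : x ≤ y) (hr : rank y ≤ rank x) : x = y := by
  by_contra hne
  exact absurd (rank_strictMono (lt_of_le_of_ne h hne)) (not_lt.mpr hr)

theorem dim_prod [Finite M] [Finite N] (hM : IsRanked M) (hN : IsRanked N) :
    dim (M × N) = dim M + dim N + 2 := by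
  have h : rank (⊤ : M × N) = rank (⊤ : M) + rank (⊤ : N) := rank_mk hM hN ⊤
  simp only [dim, h]; push_cast; ring

/-- If only one coordinate moves, this is thinness of a factor. If both move, each moves by one
rank, and the two mixed corners are the only intermediate elements. -/
theorem thin_prod (hM : IsCellularPseudomanifold M) (hN : IsCellularPseudomanifold N)
    (x z : M × N) (hxz : x < z) (hr : rank z = rank x + 2) : (Ioo x z).ncard = 2 := by
  have := hM.finite
  have := hN.finite
  obtain ⟨x₁, x₂⟩ := x
  obtain ⟨z₁, z₂⟩ := z
  rw [rank_mk hM.ranked hN.ranked, rank_mk hM.ranked hN.ranked] at hr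
  simp only at hr
  obtain ⟨h1, h2⟩ := Prod.mk_le_mk.mp hxz.le
  by_cases e1 : x₁ = z₁
  · subst e1
    have h2' : x₂ < z₂ := lt_of_le_of_ne h2 fun h => hxz.ne (by rw [h])
    rw [Ioo_mk_left, ncard_image_of_injective _ (Prod.mk_right_injective x₁)]
    exact hN.thin x₂ z₂ h2' (by omega)
  by_cases e2 : x₂ = z₂
  · subst e2
    have h1' : x₁ < z₁ := lt_of_le_of_ne h1 fun h => hxz.ne (by rw [h])
    rw [Ioo_mk_right, ncard_image_of_injective _ (Prod.mk_left_injective x₂)]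
    exact hM.thin x₁ z₁ h1' (by omega)
  have l1 := lt_of_le_of_ne h1 e1
  have l2 := lt_of_le_of_ne h2 e2
  have r1 := rank_strictMono l1
  have r2 := rank_strictMono l2
  have d1 : ∀ a, x₁ ≤ a → a ≤ z₁ → a = x₁ ∨ a = z₁ := by
    intro a ha ha'
    by_contra! hne
    have h3 := rank_strictMono (lt_of_le_of_ne ha hne.1.symm)
    have h4 := rank_strictMono (lt_of_le_of_ne ha' hne.2)
    omega
  have d2 : ∀ a, x₂ ≤ a → a ≤ z₂ → a = x₂ ∨ a = z₂ := by
    intro a ha ha'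
    by_contra! hne
    have h3 := rank_strictMono (lt_of_le_of_ne ha hne.1.symm)
    have h4 := rank_strictMono (lt_of_le_of_ne ha' hne.2)
    omega
  have hI : Ioo (x₁, x₂) (z₁, z₂) = {(x₁, z₂), (z₁, x₂)} := by
    ext ⟨a, b⟩
    constructor
    · rintro ⟨hlo, hhi⟩
      rcases d1 a hlo.le.1 hhi.le.1 with rfl | rfl <;> rcases d2 b hlo.le.2 hhi.le.2 with rfl | rfl
      · exact absurd rfl hlo.ne
      · exact .inl rfl
      · exact .inr rfl
      · exact absurd rfl hhi.ne
    · rintro (h | h) <;> obtain ⟨rfl, rfl⟩ := Prod.mk.inj h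
      · exact ⟨Prod.mk_lt_mk.mpr (.inr ⟨le_rfl, l2⟩), Prod.mk_lt_mk.mpr (.inl ⟨l1, le_rfl⟩)⟩
      · exact ⟨Prod.mk_lt_mk.mpr (.inl ⟨l1, le_rfl⟩), Prod.mk_lt_mk.mpr (.inr ⟨le_rfl, l2⟩)⟩
  rw [hI, ncard_pair]
  exact fun h => e1 (Prod.mk.inj h).1

/-- If only one coordinate moves, the graph is an image of that of a factor. Otherwise each facet of
the interval lowers exactly one coordinate by one rank. Any facet of one kind is adjacent to any
facet of the other kind, and both kinds occur. -/
theorem connected_prod (hM : IsCellularPseudomanifold M) (hN : IsCellularPseudomanifold N)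
    (x z : M × N) (hxz : x < z) (hr : rank x + 2 < rank z) : (facetGraph x z).Connected := by
  have := hM.finite
  have := hN.finite
  have rk := rank_mk hM.ranked hN.ranked
  obtain ⟨x₁, x₂⟩ := x
  obtain ⟨z₁, z₂⟩ := z
  rw [rk, rk] at hr
  simp only at hr
  obtain ⟨h1, h2⟩ := Prod.mk_le_mk.mp hxz.le
  by_cases e1 : x₁ = z₁
  · subst e1
    have h2' : x₂ < z₂ := lt_of_le_of_ne h2 fun h => hxz.ne (by rw [h])
    let f : facetGraph x₂ z₂ →g facetGraph (x₁, x₂) (x₁, z₂) :=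
      { toFun := fun y => ⟨(x₁, y.1), ⟨le_rfl, y.2.1⟩, ⟨le_rfl, y.2.2.1⟩, by
          rw [rk, rk, add_assoc, y.2.2.2]⟩
        map_rel' := fun {s t} h => by
          change rank ((x₁, s.1) ⊓ (x₁, t.1)) + 2 = rank (x₁, z₂)
          rw [Prod.mk_inf_mk, rk, rk, inf_idem, add_assoc]
          exact congrArg _ h }
    refine (hN.connected x₂ z₂ h2' (by omega)).map f ?_
    rintro ⟨⟨a, b⟩, hlo, hhi, hab⟩
    obtain rfl : a = x₁ := le_antisymm hhi.1 hlo.1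
    rw [rk, rk] at hab
    exact ⟨⟨b, hlo.2, hhi.2, by simp only at hab; omega⟩, rfl⟩
  by_cases e2 : x₂ = z₂
  · subst e2
    have h1' : x₁ < z₁ := lt_of_le_of_ne h1 fun h => hxz.ne (by rw [h])
    let f : facetGraph x₁ z₁ →g facetGraph (x₁, x₂) (z₁, x₂) :=
      { toFun := fun y => ⟨(y.1, x₂), ⟨y.2.1, le_rfl⟩, ⟨y.2.2.1, le_rfl⟩, by
          have := y.2.2.2
          rw [rk, rk]; simp only; omega⟩
        map_rel' := fun {s t} h => by
          change rank ((s.1, x₂) ⊓ (t.1, x₂)) + 2 = rank (z₁, x₂)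
          have h : rank (s.1 ⊓ t.1) + 2 = rank z₁ := h
          rw [Prod.mk_inf_mk, rk, rk, inf_idem]; simp only; omega }
    refine (hM.connected x₁ z₁ h1' (by omega)).map f ?_
    rintro ⟨⟨a, b⟩, hlo, hhi, hab⟩
    obtain rfl : b = x₂ := le_antisymm hhi.2 hlo.2
    rw [rk, rk] at hab
    exact ⟨⟨a, hlo.1, hhi.1, by simp only at hab; omega⟩, rfl⟩
  obtain ⟨a, ha, haz⟩ := exists_le_covBy_of_lt (lt_of_le_of_ne h1 e1)
  obtain ⟨b, hb, hbz⟩ := exists_le_covBy_of_lt (lt_of_le_of_ne h2 e2)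
  have ra := hM.ranked.rank_covBy haz
  have rb := hN.ranked.rank_covBy hbz
  let A : {y : M × N // (x₁, x₂) ≤ y ∧ y ≤ (z₁, z₂) ∧ rank y + 1 = rank (z₁, z₂)} :=
    ⟨(a, z₂), ⟨ha, h2⟩, ⟨haz.le, le_rfl⟩, by rw [rk, rk]; simp only; omega⟩
  let B : {y : M × N // (x₁, x₂) ≤ y ∧ y ≤ (z₁, z₂) ∧ rank y + 1 = rank (z₁, z₂)} :=
    ⟨(z₁, b), ⟨h1, hb⟩, ⟨le_rfl, hbz.le⟩, by rw [rk, rk]; simp only; omega⟩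
  have hdich : ∀ y : {y : M × N // (x₁, x₂) ≤ y ∧ y ≤ (z₁, z₂) ∧ rank y + 1 = rank (z₁, z₂)},
      (y.1.2 = z₂ ∧ rank y.1.1 + 1 = rank z₁) ∨ (y.1.1 = z₁ ∧ rank y.1.2 + 1 = rank z₂) := by
    rintro ⟨⟨c, d⟩, hlo, hhi, hcd⟩
    rw [rk, rk] at hcd
    simp only at hcd ⊢
    have m1 := rank_strictMono.monotone hhi.1
    have m2 := rank_strictMono.monotone hhi.2
    simp only at m1 m2
    by_cases hd : rank d = rank z₂
    · exact .inl ⟨eq_of_le_of_rank_le hhi.2 hd.ge, by omega⟩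
    · exact .inr ⟨eq_of_le_of_rank_le hhi.1 (by omega), by omega⟩
  have hadj : ∀ s t : {y : M × N // (x₁, x₂) ≤ y ∧ y ≤ (z₁, z₂) ∧ rank y + 1 = rank (z₁, z₂)},
      s.1.2 = z₂ → rank s.1.1 + 1 = rank z₁ → t.1.1 = z₁ → rank t.1.2 + 1 = rank z₂ →
      (facetGraph (x₁, x₂) (z₁, z₂)).Adj s t := by
    intro s t hs hs' ht ht'
    change rank (s.1 ⊓ t.1) + 2 = rank (z₁, z₂)
    have i1 : (s.1 ⊓ t.1).1 = s.1.1 := inf_eq_left.mpr (by rw [ht]; exact s.2.2.1.1)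
    have i2 : (s.1 ⊓ t.1).2 = t.1.2 := inf_eq_right.mpr (by rw [hs]; exact t.2.2.1.2)
    have e1 := rk (s.1 ⊓ t.1)
    have e2 := rk (z₁, z₂)
    rw [i1, i2] at e1
    simp only at e2
    omega
  have hreach : ∀ y, (facetGraph (x₁, x₂) (z₁, z₂)).Reachable A y := by
    intro y
    rcases hdich y with ⟨p, q⟩ | ⟨p, q⟩
    · exact (hadj A B rfl ra.symm rfl rb.symm).reachable.trans
        (hadj y B p q rfl rb.symm).reachable.symm
    · exact (hadj A y rfl ra.symm p q).reachable
  have : Nonempty {y : M × N // (x₁, x₂) ≤ y ∧ y ≤ (z₁, z₂) ∧ rank y + 1 = rank (z₁, z₂)} := ⟨A⟩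
  exact ⟨fun s t => (hreach s).symm.trans (hreach t)⟩

/-- The direct product of cellular pseudomanifolds is a cellular pseudomanifold. -/
theorem IsCellularPseudomanifold.prod (hM : IsCellularPseudomanifold M)
    (hN : IsCellularPseudomanifold N) : IsCellularPseudomanifold (M × N) := by
  have := hM.finite
  have := hN.finite
  have := hM.nontrivial
  exact ⟨inferInstance, inferInstance, isRanked_prod hM.ranked hN.ranked, thin_prod hM hN,
    connected_prod hM hN⟩

theorem rank_top_pos [Finite M] [Nontrivial M] : 0 < rank (⊤ : M) :=
  lt_of_le_of_lt (Nat.zero_le _) (rank_strictMono (bot_lt_top (α := M)))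

theorem ncard_chain_lt [Finite M] [Nontrivial M] {A : Set (Proper M)}
    (hA : A ∈ chainFaces (Proper M)) : A.ncard < rank (⊤ : M) := by
  have h1 : A.ncard ≤ (Ioo 0 (rank (⊤ : M))).ncard := by
    refine ncard_le_ncard_of_injOn (fun x => rank x.1) (fun x _ => ⟨?_, ?_⟩) ?_ (finite_Ioo _ _)
    · exact lt_of_le_of_lt (Nat.zero_le _) (rank_strictMono (bot_lt_iff_ne_bot.mpr x.2.1))
    · exact rank_strictMono (lt_top_iff_ne_top.mpr x.2.2)
    · intro x hx y hy e
      by_contra hne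
      rcases hA hx hy hne with h | h
      · exact (rank_strictMono (lt_of_le_of_ne h (Subtype.coe_ne_coe.mpr hne))).ne e
      · exact (rank_strictMono (lt_of_le_of_ne h (Subtype.coe_ne_coe.mpr (Ne.symm hne)))).ne' e
  rw [← Finset.coe_Ioo, ncard_coe_finset, Nat.card_Ioo] at h1
  have := rank_top_pos (M := M)
  omega

/-- There is a maximal chain of proper elements of the expected length. -/
theorem exists_maximal_chain (M : Type*) [Lattice M] [BoundedOrder M] [Finite M] [Nontrivial M] :
    ∃ A ∈ chainFaces (Proper M), A.ncard + 1 = rank (⊤ : M) ∧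
      ∀ B ∈ chainFaces (Proper M), A ⊆ B → B = A := by
  obtain ⟨p, hp, hlen⟩ := Order.exists_series_of_height_eq_coe (⊤ : M) (coe_rank ⊤).symm
  have hrk : ∀ i, rank (p i) = i := by
    intro i
    have := Order.height_eq_index_of_length_eq_height_last (p := p) (by rw [hp, hlen, coe_rank]) i
    rw [← coe_rank] at this
    exact_mod_cast this
  let A : Set (Proper M) := {x | ∃ i, p i = x.1}
  have hA : A ∈ chainFaces (Proper M) := by
    rintro x ⟨i, hi⟩ y ⟨j, hj⟩ -
    rcases le_total i j with h | h
    · left; change x.1 ≤ y.1; rw [← hi, ← hj]; exact p.monotone h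
    · right; change y.1 ≤ x.1; rw [← hi, ← hj]; exact p.monotone h
  -- A longest chain up to `⊤` meets every rank; by `ncard_chain_lt` no chain of proper elements has
  -- more members, whence maximality.
  have h1 : (Ioo 0 (rank (⊤ : M))).ncard ≤ A.ncard := by
    refine (ncard_le_ncard (t := (fun x : Proper M => rank x.1) '' A) ?_ (toFinite _)).trans
      (ncard_image_le (toFinite _))
    intro k hk
    have hk' : k < p.length + 1 := by rw [hlen]; exact hk.2.trans (Nat.lt_succ_self _)
    have hr := hrk ⟨k, hk'⟩
    refine ⟨⟨p ⟨k, hk'⟩, fun h => ?_, fun h => ?_⟩, ⟨_, rfl⟩, hr⟩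
    · rw [h, rank_bot] at hr; exact hk.1.ne hr
    · rw [h] at hr; exact hk.2.ne' hr
  rw [← Finset.coe_Ioo, ncard_coe_finset, Nat.card_Ioo] at h1
  have h2 := ncard_chain_lt hA
  refine ⟨A, hA, by omega, fun B hB hAB => (eq_of_subset_of_ncard_le hAB ?_ (toFinite _)).symm⟩
  have := ncard_chain_lt hB
  omega

end Rank

/-! ### Joins of polytopes and their faces -/

section PolytopeJoin

variable {m n : ℕ}

/-- The first `m` coordinates. -/
def coordLeft (m n : ℕ) : (Fin (m + n + 1) → ℝ) →L[ℝ] (Fin m → ℝ) :=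
  ContinuousLinearMap.pi fun i => ContinuousLinearMap.proj (Fin.castAdd 1 (Fin.castAdd n i))

/-- The `n` coordinates following the first `m` ones. -/
def coordRight (m n : ℕ) : (Fin (m + n + 1) → ℝ) →L[ℝ] (Fin n → ℝ) :=
  ContinuousLinearMap.pi fun i => ContinuousLinearMap.proj (Fin.castAdd 1 (Fin.natAdd m i))

/-- The last coordinate. -/
def coordLast (m n : ℕ) : (Fin (m + n + 1) → ℝ) →L[ℝ] ℝ :=
  ContinuousLinearMap.proj (Fin.natAdd (m + n) 0)

theorem ext_coord {z w : Fin (m + n + 1) → ℝ} (h1 : coordLeft m n z = coordLeft m n w)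
    (h2 : coordRight m n z = coordRight m n w) (h3 : coordLast m n z = coordLast m n w) :
    z = w := by
  ext i
  refine Fin.addCases (fun j => ?_) (fun k => ?_) i
  · refine Fin.addCases (fun a => ?_) (fun b => ?_) j
    · exact congrFun h1 a
    · exact congrFun h2 b
  · obtain rfl : k = 0 := Subsingleton.elim _ _
    exact h3

@[simp]
theorem coordLeft_joinLeft (x : Fin m → ℝ) : coordLeft m n (joinLeft m n x) = x := by
  ext i; simp [coordLeft, joinLeft]

@[simp]
theorem coordRight_joinLeft (x : Fin m → ℝ) : coordRight m n (joinLeft m n x) = 0 := by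
  ext i; simp [coordRight, joinLeft]

@[simp]
theorem coordLast_joinLeft (x : Fin m → ℝ) : coordLast m n (joinLeft m n x) = 0 := by
  simp only [coordLast, joinLeft, ContinuousLinearMap.proj_apply, Fin.append_right]

@[simp]
theorem coordLeft_joinRight (y : Fin n → ℝ) : coordLeft m n (joinRight m n y) = 0 := by
  ext i; simp [coordLeft, joinRight]

@[simp]
theorem coordRight_joinRight (y : Fin n → ℝ) : coordRight m n (joinRight m n y) = y := by
  ext i; simp [coordRight, joinRight]

@[simp]
theorem coordLast_joinRight (y : Fin n → ℝ) : coordLast m n (joinRight m n y) = 1 := by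
  simp only [coordLast, joinRight, ContinuousLinearMap.proj_apply, Fin.append_right]

/-- `joinLeft` as an affine map. -/
def joinLeftAffine (m n : ℕ) : (Fin m → ℝ) →ᵃ[ℝ] (Fin (m + n + 1) → ℝ) :=
  LinearMap.toAffineMap
    { toFun := joinLeft m n
      map_add' := fun x y => by apply ext_coord <;> simp
      map_smul' := fun c x => by apply ext_coord <;> simp }

/-- `joinRight` as an affine map. -/
def joinRightAffine (m n : ℕ) : (Fin n → ℝ) →ᵃ[ℝ] (Fin (m + n + 1) → ℝ) where
  toFun := joinRight m n
  linear :=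
    { toFun := fun y => joinRight m n y - joinRight m n 0
      map_add' := fun x y => by apply ext_coord <;> simp
      map_smul' := fun c x => by apply ext_coord <;> simp }
  map_vadd' := fun x y => by apply ext_coord <;> simp

theorem coe_joinLeftAffine : ⇑(joinLeftAffine m n) = joinLeft m n := rfl

theorem coe_joinRightAffine : ⇑(joinRightAffine m n) = joinRight m n := rfl

variable {X : Set (Fin m → ℝ)} {Y : Set (Fin n → ℝ)}

theorem polytopeJoin_eq_convexJoin :
    polytopeJoin X Y = convexJoin ℝ (joinLeft m n '' X) (joinRight m n '' Y) := by
  ext z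
  simp only [polytopeJoin, mem_convexJoin, mem_ofPred_eq, exists_mem_image]
  refine exists_congr fun x => and_congr_right fun _ => exists_congr fun y =>
    and_congr_right fun _ => ?_
  constructor
  · rintro ⟨t, ht, rfl⟩
    exact ⟨t, 1 - t, ht.1, sub_nonneg.mpr ht.2, by ring, rfl⟩
  · rintro ⟨a, b, ha, hb, hab, rfl⟩
    obtain rfl : b = 1 - a := by linarith
    exact ⟨a, ⟨ha, by linarith⟩, rfl⟩

theorem joinLeft_mem (hY : Y.Nonempty) {x : Fin m → ℝ} :
    joinLeft m n x ∈ polytopeJoin X Y ↔ x ∈ X := by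
  constructor
  · rintro ⟨x', hx', y, -, t, -, e⟩
    have h1 := congrArg (coordLast m n) e
    have h2 := congrArg (coordLeft m n) e
    simp at h1 h2
    obtain rfl : t = 1 := by linarith
    simpa [h2] using hx'
  · intro hx
    obtain ⟨y, hy⟩ := hY
    exact ⟨x, hx, y, hy, 1, by simp, by simp⟩

theorem joinRight_mem (hX : X.Nonempty) {y : Fin n → ℝ} :
    joinRight m n y ∈ polytopeJoin X Y ↔ y ∈ Y := by
  constructor
  · rintro ⟨x, -, y', hy', t, -, e⟩
    have h1 := congrArg (coordLast m n) e
    have h2 := congrArg (coordRight m n) e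
    simp at h1 h2
    obtain rfl : t = 0 := by linarith
    simpa [h2] using hy'
  · intro hy
    obtain ⟨x, hx⟩ := hX
    exact ⟨x, hx, y, hy, 0, by simp, by simp⟩

theorem IsPolytope.nonempty {d : ℕ} {Z : Set (Fin d → ℝ)} (hZ : IsPolytope Z) : Z.Nonempty :=
  hZ.2.mono interior_subset

/-- The join of two polytopes is a polytope. -/
theorem IsPolytope.join (hX : IsPolytope X) (hY : IsPolytope Y) :
    IsPolytope (polytopeJoin X Y) := by
  classical
  have hX0 := hX.nonempty
  have hY0 := hY.nonempty
  constructor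
  · obtain ⟨S, hS⟩ := hX.1
    obtain ⟨T, hT⟩ := hY.1
    refine ⟨S.image (joinLeft m n) ∪ T.image (joinRight m n), ?_⟩
    rw [hS, convexHull_nonempty_iff] at hX0
    rw [hT, convexHull_nonempty_iff] at hY0
    rw [polytopeJoin_eq_convexJoin, Finset.coe_union, Finset.coe_image, Finset.coe_image,
      convexHull_union (hX0.image _) (hY0.image _), hS, hT, ← coe_joinLeftAffine,
      ← coe_joinRightAffine, AffineMap.image_convexHull, AffineMap.image_convexHull]
  · obtain ⟨x, hx⟩ := hX.2
    obtain ⟨y, hy⟩ := hY.2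
    let z := (2⁻¹ : ℝ) • joinLeft m n x + (2⁻¹ : ℝ) • joinRight m n y
    have z1 : coordLeft m n z = (2⁻¹ : ℝ) • x := by simp [z]
    have z2 : coordRight m n z = (2⁻¹ : ℝ) • y := by simp [z]
    have z3 : coordLast m n z = 2⁻¹ := by simp [z]
    refine ⟨z, mem_interior_iff_mem_nhds.mpr ?_⟩
    -- The last coordinate of a point of the join is `1 - t`, so dividing by `t` and `1 - t`
    -- recovers its components in `X` and `Y`. These depend continuously on the point, so they stay
    -- in `X` and `Y` near the midpoint of two interior points.
    have c1 : ContinuousAt (fun w => (1 - coordLast m n w)⁻¹ • coordLeft m n w) z :=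
      (ContinuousAt.inv₀ (f := fun w => 1 - coordLast m n w) (by fun_prop) (by rw [z3]; norm_num)).smul
        (coordLeft m n).continuous.continuousAt
    have c2 : ContinuousAt (fun w => (coordLast m n w)⁻¹ • coordRight m n w) z :=
      (ContinuousAt.inv₀ (f := fun w => coordLast m n w) (by fun_prop) (by rw [z3]; norm_num)).smul
        (coordRight m n).continuous.continuousAt
    have c3 : ContinuousAt (coordLast m n) z := by fun_prop
    have h1 := c1.preimage_mem_nhds (t := X) (by
      rw [z3, z1, smul_smul]; norm_num; exact mem_interior_iff_mem_nhds.mp hx)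
    have h2 := c2.preimage_mem_nhds (t := Y) (by
      rw [z3, z2, smul_smul]; norm_num; exact mem_interior_iff_mem_nhds.mp hy)
    have h3 := c3.preimage_mem_nhds (t := Ioo 0 1) (by
      rw [z3]; exact Ioo_mem_nhds (by norm_num) (by norm_num))
    filter_upwards [h1, h2, h3] with w hw1 hw2 hw3
    refine ⟨_, hw1, _, hw2, 1 - coordLast m n w, ⟨by linarith [hw3.2], by linarith [hw3.1]⟩, ?_⟩
    have n1 : 1 - coordLast m n w ≠ 0 := by linarith [hw3.2]
    have n2 : coordLast m n w ≠ 0 := hw3.1.ne'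
    apply ext_coord
    · simp [smul_smul, n1]
    · simp [smul_smul, n2]
    · simp

/-- A nonempty preimage means that the maximum over `B` is attained at a point coming from `A`; the
pulled-back functional therefore has the same maximum on `A`, up to the constant `l c`. -/
theorem isExposed_preimage {E F : Type*} [AddCommGroup E] [TopologicalSpace E] [Module ℝ E]
    [AddCommGroup F] [TopologicalSpace F] [Module ℝ F] {L : E →L[ℝ] F} {c : F} {f : E → F}
    (hf : ∀ x, f x = L x + c) {A : Set E} {B H : Set F} (hA : ∀ x, f x ∈ B ↔ x ∈ A)
    (hH : IsExposed ℝ B H) : IsExposed ℝ A (f ⁻¹' H) := by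
  rintro ⟨x₀, hx₀⟩
  obtain ⟨l, rfl⟩ := hH ⟨_, hx₀⟩
  refine ⟨l.comp L, ?_⟩
  have key : ∀ x y, l (f y) ≤ l (f x) ↔ l.comp L y ≤ l.comp L x := by
    intro x y; simp [hf]
  ext x
  constructor
  · rintro ⟨hx, hmax⟩
    exact ⟨(hA x).mp hx, fun y hy => (key x y).mp (hmax _ ((hA y).mpr hy))⟩
  · rintro ⟨hx, hmax⟩
    exact ⟨(hA x).mpr hx, fun w hw =>
      (hx₀.2 w hw).trans ((key x x₀).mpr (hmax x₀ ((hA x₀).mp hx₀.1)))⟩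

theorem isExposed_joinLeft_preimage (hY : Y.Nonempty) {H : Set (Fin (m + n + 1) → ℝ)}
    (hH : IsExposed ℝ (polytopeJoin X Y) H) : IsExposed ℝ X (joinLeft m n ⁻¹' H) :=
  isExposed_preimage (L := (joinLeftAffine m n).linear.toContinuousLinearMap) (c := 0)
    (fun _ => (add_zero _).symm) (fun _ => joinLeft_mem hY) hH

theorem isExposed_joinRight_preimage (hX : X.Nonempty) {H : Set (Fin (m + n + 1) → ℝ)}
    (hH : IsExposed ℝ (polytopeJoin X Y) H) : IsExposed ℝ Y (joinRight m n ⁻¹' H) :=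
  isExposed_preimage (L := (joinRightAffine m n).linear.toContinuousLinearMap)
    (c := joinRight m n 0) (fun _ => (sub_add_cancel _ _).symm) (fun _ => joinRight_mem hX) hH

theorem IsPolytope.convex {d : ℕ} {Z : Set (Fin d → ℝ)} (hZ : IsPolytope Z) : Convex ℝ Z := by
  obtain ⟨S, rfl⟩ := hZ.1
  exact convex_convexHull ℝ _

/-- Faces are extreme: a point of `H` in the interior of a joining segment forces both end points
into `H`, hence into `H'`, and convexity of `H'` returns the point. -/
theorem subset_of_preimages_subset (hX : X.Nonempty) (hY : Y.Nonempty)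
    (hJ : Convex ℝ (polytopeJoin X Y)) {H H' : Set (Fin (m + n + 1) → ℝ)}
    (hH : IsExposed ℝ (polytopeJoin X Y) H) (hH' : IsExposed ℝ (polytopeJoin X Y) H')
    (h1 : joinLeft m n ⁻¹' H ⊆ joinLeft m n ⁻¹' H')
    (h2 : joinRight m n ⁻¹' H ⊆ joinRight m n ⁻¹' H') : H ⊆ H' := by
  intro z hz
  obtain ⟨x, hx, y, hy, t, ht, rfl⟩ := hH.subset hz
  rcases eq_or_lt_of_le ht.1 with rfl | h0
  · have e : (0 : ℝ) • joinLeft m n x + (1 - 0 : ℝ) • joinRight m n y = joinRight m n y := by simp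
    rw [e] at hz ⊢
    exact h2 hz
  rcases eq_or_lt_of_le ht.2 with rfl | h01
  · have e : (1 : ℝ) • joinLeft m n x + (1 - 1 : ℝ) • joinRight m n y = joinLeft m n x := by simp
    rw [e] at hz ⊢
    exact h1 hz
  have hseg : t • joinLeft m n x + (1 - t) • joinRight m n y ∈
      openSegment ℝ (joinLeft m n x) (joinRight m n y) :=
    ⟨t, 1 - t, h0, sub_pos.mpr h01, by ring, rfl⟩
  have hxH := hH.isExtreme.left_mem_of_mem_openSegment ((joinLeft_mem hY).mpr hx)
    ((joinRight_mem hX).mpr hy) hz hseg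
  have hyH := hH.isExtreme.left_mem_of_mem_openSegment ((joinRight_mem hX).mpr hy)
    ((joinLeft_mem hY).mpr hx) hz (by rwa [openSegment_symm])
  exact (hH'.convex hJ) (h1 hxH) (h2 hyH) ht.1 (sub_nonneg.mpr ht.2) (by ring)

/-- The functionals `a` and `b + c` glue to a single linear functional, because the last coordinate
is 0 on the copy of `X` and 1 on that of `Y`. It suffices that the bound `μ` is attained on one
side; the other trace may be empty. -/
theorem exists_face_of_functionals (hX : X.Nonempty) (hY : Y.Nonempty)
    (a : (Fin m → ℝ) →L[ℝ] ℝ) (b : (Fin n → ℝ) →L[ℝ] ℝ) (c μ : ℝ) (ha : ∀ x ∈ X, a x ≤ μ)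
    (hb : ∀ y ∈ Y, b y + c ≤ μ) (hatt : (∃ x ∈ X, a x = μ) ∨ ∃ y ∈ Y, b y + c = μ) :
    ∃ H, IsExposed ℝ (polytopeJoin X Y) H ∧ joinLeft m n ⁻¹' H = {x ∈ X | a x = μ} ∧
      joinRight m n ⁻¹' H = {y ∈ Y | b y + c = μ} := by
  let l : (Fin (m + n + 1) → ℝ) →L[ℝ] ℝ :=
    a.comp (coordLeft m n) + b.comp (coordRight m n) + c • coordLast m n
  have l1 : ∀ x, l (joinLeft m n x) = a x := fun x => by simp [l]
  have l2 : ∀ y, l (joinRight m n y) = b y + c := fun y => by simp [l]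
  have hle : ∀ z ∈ polytopeJoin X Y, l z ≤ μ := by
    rintro z ⟨x, hx, y, hy, t, ht, rfl⟩
    rw [map_add, map_smul, map_smul, l1, l2, smul_eq_mul, smul_eq_mul]
    nlinarith [mul_le_mul_of_nonneg_left (ha x hx) ht.1,
      mul_le_mul_of_nonneg_left (hb y hy) (sub_nonneg.mpr ht.2)]
  have hatt' : ∃ z ∈ polytopeJoin X Y, l z = μ := by
    rcases hatt with ⟨x, hx, h⟩ | ⟨y, hy, h⟩
    · exact ⟨_, (joinLeft_mem hY).mpr hx, (l1 x).trans h⟩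
    · exact ⟨_, (joinRight_mem hX).mpr hy, (l2 y).trans h⟩
  have hmem : ∀ z, z ∈ l.toExposed (polytopeJoin X Y) ↔ z ∈ polytopeJoin X Y ∧ l z = μ := by
    intro z
    constructor
    · rintro ⟨hz, hmax⟩
      obtain ⟨w, hw, hwμ⟩ := hatt'
      exact ⟨hz, le_antisymm (hle z hz) (hwμ ▸ hmax w hw)⟩
    · rintro ⟨hz, h⟩
      exact ⟨hz, fun w hw => (hle w hw).trans h.ge⟩
  refine ⟨l.toExposed (polytopeJoin X Y), ContinuousLinearMap.toExposed.isExposed, ?_, ?_⟩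
  · ext x
    rw [mem_preimage, hmem, joinLeft_mem hY, l1]; rfl
  · ext y
    rw [mem_preimage, hmem, joinRight_mem hX, l2]; rfl

theorem IsExposed.exists_max {E : Type*} [AddCommGroup E] [TopologicalSpace E] [Module ℝ E]
    {A B : Set E} (h : IsExposed ℝ A B) (hB : B.Nonempty) : ∃ (l : E →L[ℝ] ℝ) (μ : ℝ),
      (∀ x ∈ A, l x ≤ μ) ∧ (∃ x ∈ A, l x = μ) ∧ {x ∈ A | l x = μ} = B := by
  obtain ⟨l, rfl⟩ := h hB
  obtain ⟨x, hx, hmax⟩ := hB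
  refine ⟨l, l x, hmax, ⟨x, hx, rfl⟩, ?_⟩
  ext y
  constructor
  · rintro ⟨hy, e⟩
    exact ⟨hy, fun w hw => (hmax w hw).trans e.ge⟩
  · rintro ⟨hy, hy'⟩
    exact ⟨hy, le_antisymm (hmax y hy) (hy' x hx)⟩

theorem exists_face_of_faces (hX : X.Nonempty) (hY : Y.Nonempty) {F : Set (Fin m → ℝ)}
    {G : Set (Fin n → ℝ)} (hF : IsExposed ℝ X F) (hG : IsExposed ℝ Y G) :
    ∃ H, IsExposed ℝ (polytopeJoin X Y) H ∧ joinLeft m n ⁻¹' H = F ∧ joinRight m n ⁻¹' H = G := by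
  rcases F.eq_empty_or_nonempty with rfl | hF0 <;> rcases G.eq_empty_or_nonempty with rfl | hG0
  · exact ⟨∅, isExposed_empty, rfl, rfl⟩
  · obtain ⟨b, μ, hb, ⟨y, hy, hyμ⟩, rfl⟩ := IsExposed.exists_max hG hG0
    -- The constant raises the maximum on `Y` to 1, while the functional is 0 on `X`, so `X` is
    -- missed.
    obtain ⟨H, hH, h1, h2⟩ := exists_face_of_functionals hX hY 0 b (1 - μ) 1
      (fun x _ => by simp) (fun y hy => by linarith [hb y hy]) (.inr ⟨y, hy, by linarith⟩)
    refine ⟨H, hH, by rw [h1]; simp, h2.trans ?_⟩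
    ext y
    exact and_congr_right fun _ => ⟨fun h => by linarith, fun h => by linarith⟩
  · obtain ⟨a, μ, ha, hatt, rfl⟩ := IsExposed.exists_max hF hF0
    -- On `Y` the value is `μ - 1`, below the maximum, so `Y` is missed.
    obtain ⟨H, hH, h1, h2⟩ := exists_face_of_functionals hX hY a 0 (μ - 1) μ ha
      (fun y _ => by simp) (.inl hatt)
    exact ⟨H, hH, h1, by rw [h2]; simp⟩
  · obtain ⟨a, μ, ha, hatt, rfl⟩ := IsExposed.exists_max hF hF0
    obtain ⟨b, ν, hb, -, rfl⟩ := IsExposed.exists_max hG hG0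
    -- The constant `μ - ν` makes the two maxima coincide.
    obtain ⟨H, hH, h1, h2⟩ := exists_face_of_functionals hX hY a b (μ - ν) μ ha
      (fun y hy => by linarith [hb y hy]) (.inl hatt)
    refine ⟨H, hH, h1, h2.trans ?_⟩
    ext y
    exact and_congr_right fun _ => ⟨fun h => by linarith, fun h => by linarith⟩

/-- The faces of a join are the joins of faces. -/
theorem nonempty_orderIso_boundaryComplex_join (hX : IsPolytope X) (hY : IsPolytope Y) :
    Nonempty (BoundaryComplex (polytopeJoin X Y) ≃o BoundaryComplex X × BoundaryComplex Y) := by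
  let f : BoundaryComplex (polytopeJoin X Y) → BoundaryComplex X × BoundaryComplex Y := fun H =>
    (⟨_, isExposed_joinLeft_preimage hY.nonempty H.2⟩,
      ⟨_, isExposed_joinRight_preimage hX.nonempty H.2⟩)
  have hf : ∀ H H', f H ≤ f H' ↔ H ≤ H' := fun H H' =>
    ⟨fun h => subset_of_preimages_subset hX.nonempty hY.nonempty (hX.join hY).convex H.2 H'.2
      h.1 h.2, fun h => ⟨preimage_mono h, preimage_mono h⟩⟩
  refine ⟨RelIso.ofSurjective (OrderEmbedding.ofMapLEIff f hf) ?_⟩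
  rintro ⟨⟨F, hF⟩, ⟨G, hG⟩⟩
  obtain ⟨H, hH, rfl, rfl⟩ := exists_face_of_faces hX.nonempty hY.nonempty hF hG
  exact ⟨⟨H, hH⟩, rfl⟩

theorem nonempty_orderIso_prod {A B C D : Type*} [LE A] [LE B] [LE C] [LE D] (e : A ≃o B)
    (e' : C ≃o D) : Nonempty (A × C ≃o B × D) :=
  ⟨{ toEquiv := Equiv.prodCongr e.toEquiv e'.toEquiv
     map_rel_iff' := and_congr e.le_iff_le e'.le_iff_le }⟩

theorem nonempty_orderIso_join {M N : Type*} [Lattice M] [Lattice N] (hX : IsPolytope X)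
    (hY : IsPolytope Y) (eM : M ≃o BoundaryComplex X) (eN : N ≃o BoundaryComplex Y) :
    Nonempty (M × N ≃o BoundaryComplex (polytopeJoin X Y)) := by
  obtain ⟨e⟩ := nonempty_orderIso_boundaryComplex_join hX hY
  obtain ⟨e'⟩ := nonempty_orderIso_prod eM eN
  exact ⟨e'.trans e.symm⟩

end PolytopeJoin

/-! ### Assembly of the theorem -/

section Main

variable {M N : Type*} [Lattice M] [BoundedOrder M] [Lattice N] [BoundedOrder N]

theorem isCombinatorialSphere_barycentric_iff [Finite M] [Nontrivial M] :
    IsCombinatorialSphere (dim M) (barycentric M) ↔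
      PLEquiv (cone (chainFaces (Proper M))) (univ : Set (Fin (rank (⊤ : M) - 1) → ℝ)) := by
  have hr := rank_top_pos (M := M)
  rw [isCombinatorialSphere_iff (F := Fin (rank (⊤ : M) - 1) → ℝ), faceSets_barycentric]
  rw [Module.finrank_fintype_fun_eq_card, Fintype.card_fin, dim]
  omega

/-- Reflexivity is not automatic, since the set must be exhibited as the linear image of a cone over
a complex; here the boundary of a simplex serves. -/
theorem plEquiv_univ (F : Type*) [AddCommGroup F] [Module ℝ F] [FiniteDimensional ℝ F] :
    PLEquiv (univ : Set F) (univ : Set F) := by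
  have h : PLEquiv (cone (V := Fin (Module.finrank ℝ F + 1))
      ⟨{s | s ≠ univ}, fun s t hts hs ht => hs (univ_subset_iff.mp (ht ▸ hts))⟩)
      (univ : Set F) := PLEquiv.boundary_simplex (fun _ => Iff.rfl) (by simp)
  exact h.symm.trans h

/-- The direct product of cellular spheres is a cellular sphere. -/
theorem IsCellularSphere.prod (hM : IsCellularSphere M) (hN : IsCellularSphere N) :
    IsCellularSphere (M × N) := by
  have := hM.1.finite
  have := hN.1.finite
  have := hM.1.nontrivial
  have := hN.1.nontrivial
  cases nonempty_fintype M
  cases nonempty_fintype N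
  refine ⟨hM.1.prod hN.1, isCombinatorialSphere_barycentric_iff.mpr ?_⟩
  have h := (PLEquiv.of_cone (bijOn_mergeMap (P := M) (Q := N))).trans
    ((isCombinatorialSphere_barycentric_iff.mp hM.2).prod
      ((isCombinatorialSphere_barycentric_iff.mp hN.2).prod (plEquiv_univ ℝ)))
  rw [univ_prod_univ, univ_prod_univ] at h
  refine h.univ_congr ?_
  have h1 := rank_top_pos (M := M)
  have h2 := rank_top_pos (M := N)
  have h3 : rank (⊤ : M × N) = rank (⊤ : M) + rank (⊤ : N) :=
    rank_mk hM.1.ranked hN.1.ranked ⊤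
  simp only [Module.finrank_prod, Module.finrank_fintype_fun_eq_card, Fintype.card_fin,
    Module.finrank_self, h3]
  omega

/-- The element `(⊤, ⊥)` of a product. -/
def topBot (M N : Type*) [Lattice M] [BoundedOrder M] [Lattice N] [BoundedOrder N] [Nontrivial M]
    [Nontrivial N] : Proper (M × N) :=
  ⟨(⊤, ⊥), fun h => top_ne_bot (congrArg Prod.fst h), fun h => bot_ne_top (congrArg Prod.snd h)⟩

/-- The marginals of the unit matrix at `(⊤, ⊥)` sit at `⊤` and at `⊥`, hence have no proper part;
what remains is a pole of the `S⁰` factor. -/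
theorem mergeMap_topBot [Fintype M] [Fintype N] [Nontrivial M] [Nontrivial N]
    [DecidableEq (Proper (M × N))] :
    mergeMap M N (Pi.single (topBot M N) 1) = (0, 0, -1) := by
  classical
  have hext : extendProper (M × N) (Pi.single (topBot M N) 1) = Pi.single (⊤, ⊥) 1 := by
    ext z
    by_cases hz : z ≠ ⊥ ∧ z ≠ ⊤
    · have := extendProper_apply (Pi.single (topBot M N) 1) ⟨z, hz⟩
      refine this.trans ?_
      by_cases h : z = (⊤, ⊥)
      · subst h; rw [Pi.single_eq_same]; exact Pi.single_eq_same (topBot M N) 1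
      · rw [Pi.single_eq_of_ne h, Pi.single_eq_of_ne]
        exact fun h' => h (congrArg Subtype.val h')
    · rw [extendProper_of_not _ hz, Pi.single_eq_of_ne]
      rintro rfl
      exact hz (topBot M N).2
  have hr : ∀ x, rowSum (Pi.single ((⊤ : M), (⊥ : N)) 1) x = (Pi.single ⊤ 1 : M → ℝ) x := by
    intro x
    rw [rowSum_apply]
    by_cases h : x = ⊤ <;> simp [Pi.single_apply, h]
  have hc : ∀ y, colSum (Pi.single ((⊤ : M), (⊥ : N)) 1) y = (Pi.single ⊥ 1 : N → ℝ) y := by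
    intro y
    rw [colSum_apply]
    by_cases h : y = ⊥ <;> simp [Pi.single_apply, h]
  rw [mergeMap_apply, hext]
  refine Prod.ext (funext fun x => ?_) (Prod.ext (funext fun y => ?_) ?_)
  · change rowSum _ x.1 = 0
    rw [hr, Pi.single_eq_of_ne x.2.2]
  · change colSum _ y.1 = 0
    rw [hc, Pi.single_eq_of_ne y.2.1]
  · change rowSum _ ⊥ - colSum _ ⊥ = -1
    rw [hr, hc, Pi.single_eq_of_ne bot_ne_top, Pi.single_eq_same]
    norm_num

/-- The link of `(⊤, ⊥)` in the order complex of the proper part of a product is the join of the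
order complexes of the proper parts of the factors. -/
theorem plEquiv_link_topBot [Fintype M] [Fintype N] [Nontrivial M] [Nontrivial N] :
    PLEquiv (cone (linkFaces (chainFaces (Proper (M × N))) (topBot M N)))
      (cone (chainFaces (Proper M)) ×ˢ cone (chainFaces (Proper N))) := by
  classical
  let π : (Proper M → ℝ) × (Proper N → ℝ) × ℝ →ₗ[ℝ] (Proper M → ℝ) × (Proper N → ℝ) :=
    (LinearMap.fst ℝ _ _).prod (LinearMap.fst ℝ _ _ ∘ₗ LinearMap.snd ℝ _ _)
  have hπ : ∀ a b c, π (a, b, c) = (a, b) := fun _ _ _ => rfl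
  refine PLEquiv.of_cone (bijOn_linkFaces (π := π) bijOn_mergeMap IsChain.singleton ?_ ?_ ?_)
  · rw [mergeMap_topBot]
    ext ⟨a, b, c⟩
    rw [LinearMap.mem_ker, Submodule.mem_span_singleton, hπ]
    constructor
    · intro h
      obtain ⟨rfl, rfl⟩ := Prod.mk.inj h
      exact ⟨-c, by simp⟩
    · rintro ⟨d, hd⟩
      simp only [Prod.smul_mk, smul_zero, Prod.mk.injEq] at hd
      rw [← hd.1, ← hd.2.1]; rfl
  -- Moving along `(0, 0, -1)` changes only the unconstrained real coordinate, so the condition does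
  -- not depend on the parameter.
  · rintro ⟨a, b, c⟩
    rw [mergeMap_topBot, hπ]
    simp only [Prod.smul_mk, smul_zero, Prod.mk_add_mk, add_zero, mem_prod, mem_univ, and_true,
      eventually_const]
  · rintro ⟨a, b⟩ -
    exact ⟨(a, b, 0), rfl⟩

/-- A factor of a join that is a piecewise linear sphere is a piecewise linear sphere. -/
theorem isCombinatorialSphere_of_prod [Finite M] [Finite N] [Nontrivial M] [Nontrivial N]
    (h : PLEquiv (cone (chainFaces (Proper M)) ×ˢ cone (chainFaces (Proper N)))
      (univ : Set (Fin (rank (⊤ : M) - 1 + (rank (⊤ : N) - 1)) → ℝ))) :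
    IsCombinatorialSphere (dim M) (barycentric M) := by
  obtain ⟨A, hA, hcard, hmax⟩ := exists_maximal_chain N
  exact isCombinatorialSphere_barycentric_iff.mpr (PLEquiv.of_join _ _ (by omega) hA hmax
    ((PLEquiv.of_cone (bijOn_joinFaces _ _)).trans h))

/-- If the direct product is a cellular manifold, then the factors are cellular spheres. -/
theorem IsCellularManifold.factors (hM : IsCellularPseudomanifold M)
    (hN : IsCellularPseudomanifold N) (h : IsCellularManifold (M × N)) :
    IsCellularSphere M ∧ IsCellularSphere N := by
  have := hM.finite
  have := hN.finite
  have := hM.nontrivial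
  have := hN.nontrivial
  cases nonempty_fintype M
  cases nonempty_fintype N
  have hx : {topBot M N} ∈ (barycentric (M × N)).faces :=
    ⟨Finset.singleton_nonempty _, by rw [Finset.coe_singleton]; exact IsChain.singleton⟩
  have r1 := rank_top_pos (M := M)
  have r2 := rank_top_pos (M := N)
  have hs := h.2 _ hx
  -- The link has dimension `dim (M × N) - 1`, and the dimension of its cone, one more, is the sum
  -- of the ranks of the two tops minus 2.
  rw [isCombinatorialSphere_iff (F := Fin (rank (⊤ : M) - 1 + (rank (⊤ : N) - 1)) → ℝ),
    faceSets_link hx, faceSets_barycentric] at hs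
  · have hs' := plEquiv_link_topBot.symm.trans hs
    have hswap : BijOn (LinearEquiv.prodComm ℝ (Proper N → ℝ) (Proper M → ℝ)).toLinearMap
        (cone (chainFaces (Proper N)) ×ˢ cone (chainFaces (Proper M)))
        (cone (chainFaces (Proper M)) ×ˢ cone (chainFaces (Proper N))) :=
      ⟨fun z hz => ⟨hz.2, hz.1⟩, (LinearEquiv.injective _).injOn,
        fun z hz => ⟨z.swap, ⟨hz.2, hz.1⟩, rfl⟩⟩
    refine ⟨⟨hM, isCombinatorialSphere_of_prod hs'⟩, ⟨hN, isCombinatorialSphere_of_prod (N := M) ?_⟩⟩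
    have hj := ((PLEquiv.of_cone (bijOn_joinFaces _ _)).map hswap).trans hs'
    refine ((PLEquiv.of_cone (bijOn_joinFaces _ _)).symm.trans hj).univ_congr ?_
    simp [add_comm]
  · rw [Module.finrank_fintype_fun_eq_card, Fintype.card_fin, dim_prod hM.ranked hN.ranked]
    simp only [dim]
    omega

theorem IsPolytopal.prod (hM : IsPolytopal M) (hN : IsPolytopal N) : IsPolytopal (M × N) := by
  obtain ⟨hM, m, X, hX, ⟨eM⟩⟩ := hM
  obtain ⟨hN, n, Y, hY, ⟨eN⟩⟩ := hN
  exact ⟨hM.prod hN, _, _, hX.join hY, nonempty_orderIso_join hX hY eM eN⟩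

end Main

end CellPM

theorem theorem2p3 {M N : Type*} [Lattice M] [BoundedOrder M] [Lattice N] [BoundedOrder N]
    (hM : CellPM.IsCellularPseudomanifold M) (hN : CellPM.IsCellularPseudomanifold N) :
    (CellPM.IsCellularSphere M → CellPM.IsCellularSphere N →
      CellPM.IsCellularSphere (CellPM.DirectProduct M N)) ∧
    (CellPM.IsPolytopal M → CellPM.IsPolytopal N →
      CellPM.IsPolytopal (CellPM.DirectProduct M N)) ∧
    (∀ (m n : ℕ) (X : Set (Fin m → ℝ)) (Y : Set (Fin n → ℝ)),
      CellPM.IsPolytope X → CellPM.IsPolytope Y →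
      Nonempty (M ≃o CellPM.BoundaryComplex X) → Nonempty (N ≃o CellPM.BoundaryComplex Y) →
      CellPM.IsPolytope (CellPM.polytopeJoin X Y) ∧
      Nonempty (CellPM.DirectProduct M N ≃o CellPM.BoundaryComplex (CellPM.polytopeJoin X Y))) ∧
    (CellPM.IsCellularManifold (CellPM.DirectProduct M N) →
      CellPM.IsCellularSphere M ∧ CellPM.IsCellularSphere N ∧
      CellPM.IsCellularSphere (CellPM.DirectProduct M N)) := by
  refine ⟨fun h h' => h.prod h', fun h h' => h.prod h', ?_, fun h => ?_⟩
  · rintro m n X Y hX hY ⟨eM⟩ ⟨eN⟩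
    exact ⟨hX.join hY, CellPM.nonempty_orderIso_join hX hY eM eN⟩
  · obtain ⟨h1, h2⟩ := h.factors hM hN
    exact ⟨h1, h2, h1.prod h2⟩
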